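/- **Lemma (density of convexely derived measures).** Let $\mathbb S^n$ be the unit sphere of $\mathbb R^{n+1}$ and let $0\le k\le n$. A set $S\subset\mathbb S^n$ is called *convex* if it is contained in a closed hemisphere and the cone $\{tx: t\ge 0,\ x\in S\}$ is convex; it has *dimension $k$* if its linear span has dimension $k+1$, and its *relative interior* is its interior in the $k$-sphere $\mathbb S^n\cap \mathrm{span}(S)$. A *convexely derived measure* is a Radon measure on $\mathbb S^n$ that is the vague limit of a sequence of probability measures $\mathrm{vol}|_{S_i}/\mathrm{vol}(S_i)$, where the $S_i\subset\mathbb S^n$ are nonempty, open and convex. A real function $g$ on an interval of length less than $2\pi$ is *$\sin$-concave* if, transported by a unit speed parametrization of the unit circle, it extends to a concave function $F$ on a convex cone of $\mathbb R^2$ that is $1$-homogeneous ($F(cx)=cF(x)$ for $c>0$). For an integer $m\ge1$, a nonnegative function $g$ is *$\sin^m$-concave* if $g^{1/m}$ is $\sin$-concave; by convention, *$\sin^0$-concave* means nonnegative and constant. Let $S\subset\mathbb S^n$ be a convex set of dimension $k$ and let $\mu$ be a convexely derived measure on $S$, i.e. one whose support is the closure of $S$. Then $\mu$ is a probability measure,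 and there is a function $f:S\to[0,\infty)$ such that 1. $\mu=f\cdot \mathrm{vol}_k|_S$, where $\mathrm{vol}_k$ is the canonical Riemannian measure of the $k$-sphere $\mathbb S^n\cap\mathrm{span}(S)$; 2. $f$ is continuous on the relative interior of $S$ and upper semicontinuous on $S$; 3. on every geodesic arc (arc of a great circle of length less than $2\pi$, parametrized by arc length on a closed interval) contained in $S$, boundary arcs included, $f$ is continuous and $\sin^{n-k}$-concave. -/

import Mathlib

open Set Filter Topology MeasureTheory

/-- The unit sphere `𝕊ⁿ` in `ℝⁿ⁺¹`. -/
abbrev Sph (n : ℕ) : Type := Metric.sphere (0 : EuclideanSpace ℝ (Fin (n + 1))) 1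

/-- The cone with vertex at the origin over a subset of the sphere. -/
def coneOver {n : ℕ} (S : Set (Sph n)) : Set (EuclideanSpace ℝ (Fin (n + 1))) :=
  {y | ∃ t : ℝ, 0 ≤ t ∧ ∃ x ∈ S, y = t • (x : EuclideanSpace ℝ (Fin (n + 1)))}

/-- A subset of the sphere is (geodesically) convex if it is contained in a (closed) hemisphere
and the cone over it is convex. -/
def SphConvex {n : ℕ} (S : Set (Sph n)) : Prop :=
  (∃ v : Sph n, ∀ x ∈ S, 0 ≤ inner ℝ (v : EuclideanSpace ℝ (Fin (n + 1))) x) ∧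
    Convex ℝ (coneOver S)

/-- The linear span of a subset of the sphere. -/
def linSpan {n : ℕ} (S : Set (Sph n)) : Submodule ℝ (EuclideanSpace ℝ (Fin (n + 1))) :=
  Submodule.span ℝ ((fun x : Sph n => (x : EuclideanSpace ℝ (Fin (n + 1)))) '' S)

/-- A convex subset of the sphere has dimension `k` if it spans a linear subspace of dimension
`k + 1`, that is, the smallest great sphere containing it is a `k`-sphere. -/
def SphDim {n : ℕ} (S : Set (Sph n)) (k : ℕ) : Prop :=
  Module.finrank ℝ (linSpan S) = k + 1

/-- The relative interior of `S`: its interior relative to the great sphere spanned by `S`. -/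
def relInterior {n : ℕ} (S : Set (Sph n)) : Set (Sph n) :=
  {x | x ∈ S ∧ ∀ᶠ y : Sph n in 𝓝 x, (y : EuclideanSpace ℝ (Fin (n + 1))) ∈ linSpan S → y ∈ S}

/-- The canonical Riemannian measure of `𝕊ⁿ`, i.e. `(n + 1)` times the Lebesgue measure of the
truncated cone. -/
noncomputable def sphVol (n : ℕ) : Measure (Sph n) :=
  (volume : Measure (EuclideanSpace ℝ (Fin (n + 1)))).toSphere

/-- The inclusion in `𝕊ⁿ` of the unit sphere of a linear subspace. -/
def greatSphereIncl {n : ℕ} (V : Submodule ℝ (EuclideanSpace ℝ (Fin (n + 1))))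
    (x : Metric.sphere (0 : V) 1) : Sph n :=
  ⟨((x : V) : EuclideanSpace ℝ (Fin (n + 1))), by
    have h := x.2
    rw [mem_sphere_zero_iff_norm] at h ⊢
    exact h⟩

/-- The canonical Riemannian measure of the great sphere `𝕊ⁿ ∩ V`, as a measure on `𝕊ⁿ`.
The measure `(stdOrthonormalBasis ℝ V).toBasis.addHaar` is the Lebesgue measure of the Euclidean
space `V`, normalized on orthonormal bases. -/
noncomputable def greatSphereVol {n : ℕ} (V : Submodule ℝ (EuclideanSpace ℝ (Fin (n + 1)))) :
    Measure (Sph n) :=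
  Measure.map (greatSphereIncl V)
    (Measure.toSphere (stdOrthonormalBasis ℝ V).toBasis.addHaar)

/-- Convexely derived measures on `𝕊ⁿ`: the (Radon) measures that are vague limits of sequences of
normalized volumes `vol|Sᵢ / vol(Sᵢ)` of nonempty open convex sets. -/
def IsConvexelyDerived {n : ℕ} (μ : Measure (Sph n)) : Prop :=
  IsFiniteMeasureOnCompacts μ ∧
    ∃ S : ℕ → Set (Sph n),
      (∀ i, IsOpen (S i) ∧ (S i).Nonempty ∧ SphConvex (S i)) ∧
      ∀ φ : Sph n → ℝ, Continuous φ → HasCompactSupport φ →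
        Tendsto (fun i => ∫ x, φ x ∂(ProbabilityTheory.cond (sphVol n) (S i))) atTop
          (𝓝 (∫ x, φ x ∂μ))

/-- `sin`-concavity of a function on a set `I` of angles (in the applications an interval of length
less than `2π`): transported to the unit circle, the function extends to a `1`-homogeneous concave
function on a convex cone of `ℝ²`. -/
def SinConcaveOn (I : Set ℝ) (g : ℝ → ℝ) : Prop :=
  ∃ (C : ConvexCone ℝ (EuclideanSpace ℝ (Fin 2))) (F : EuclideanSpace ℝ (Fin 2) → ℝ),
    ConcaveOn ℝ (C : Set (EuclideanSpace ℝ (Fin 2))) F ∧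
    (∀ c : ℝ, 0 < c → ∀ x ∈ C, F (c • x) = c * F x) ∧
    ∀ t ∈ I, !₂[Real.cos t, Real.sin t] ∈ C ∧ F !₂[Real.cos t, Real.sin t] = g t

/-- `sin^m`-concavity of a nonnegative function: `g ^ (1 / m)` is `sin`-concave. For `m = 0` it
means, by convention, that the function is constant. -/
def SinPowConcaveOn (m : ℕ) (I : Set ℝ) (g : ℝ → ℝ) : Prop :=
  (∀ t ∈ I, 0 ≤ g t) ∧
    (m = 0 → ∀ s ∈ I, ∀ t ∈ I, g s = g t) ∧
    (0 < m → SinConcaveOn I (fun t => g t ^ ((m : ℝ)⁻¹)))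

/-- Unit speed parametrizations of great circles of `𝕊ⁿ`. -/
def IsUnitSpeedGeodesic {n : ℕ} (γ : ℝ → Sph n) : Prop :=
  ∃ u v : EuclideanSpace ℝ (Fin (n + 1)), ‖u‖ = 1 ∧ ‖v‖ = 1 ∧ inner ℝ u v = 0 ∧
    ∀ t, (γ t : EuclideanSpace ℝ (Fin (n + 1))) = Real.cos t • u + Real.sin t • v

open scoped ENNReal

/-! The problem is moved from the sphere to cones. With V the span of S, N = n+1 and m = n-k,
replace a measure on the sphere by the measure on the cone whose radial part is r^n dr
(`coneMeasure`). The normalized volume of an open convex set becomes a multiple of Lebesgue measure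
on a convex cone, and such measures satisfy the Brunn-Minkowski inequality with exponent 1/N. This
inequality, tested on balls, survives vague limits (`brunn_minkowski_of_tendsto`), as long as both
balls on the left have positive measure; the assumption on the support of μ guarantees this at all
points of the closed cone K over S in V.

The limit ν is thus a measure on K, homogeneous of degree N, where dim V = N - m. Borell's argument
(`exists_density_of_brunn_minkowski`) turns the inequality for balls into a statement on the lower
density D of ν with respect to Lebesgue measure on V. D is finite on K, so ν has no singular part. D
is homogeneous of degree m, and comparing balls around x and y whose radii are in the ratio
D(x)^(1/m) : D(y)^(1/m) gives that D^(1/m) is superadditive, that is, concave and 1-homogeneous. For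
m = 0, D is constant on the interior.

Replacing D^(1/m) by its limits along an interior direction makes it upper semicontinuous on all of
K without changing it in the interior, hence almost everywhere. Since a finite measure on the sphere
is determined by its cone measure (`coneMeasure_injective`), the density descends to μ. On an arc,
concavity gives lower semicontinuity even at boundary points, whence continuity; sin-concavity is
the pullback of a concave homogeneous function by a linear map from the plane. -/

/-! ### Prékopa-Leindler and Brunn-Minkowski inequalities -/

/-- For compact pieces K of A and L of B, the translates K + min L and max K + L lie in C and meet
only at max K + min L, so their lengths add up. Inner regularity does the rest. -/
theorem Real.volume_add_volume_le {A B C : Set ℝ} (hA : MeasurableSet A) (hB : MeasurableSet B)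
    (hA0 : A.Nonempty) (hB0 : B.Nonempty) (h : ∀ a ∈ A, ∀ b ∈ B, a + b ∈ C) :
    volume A + volume B ≤ volume C := by
  obtain ⟨a₀, ha₀⟩ := hA0
  obtain ⟨b₀, hb₀⟩ := hB0
  have key : ∀ K : Set ℝ, K ⊆ A ∧ IsCompact K → ∀ L : Set ℝ, L ⊆ B ∧ IsCompact L →
      volume K + volume L ≤ volume C := by
    rintro K ⟨hKA, hK⟩ L ⟨hLB, hL⟩
    rcases K.eq_empty_or_nonempty with rfl | hK0
    -- An empty compact piece has no extremal point; a fixed point of A serves to translate L into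
    -- C.
    · rw [measure_empty, zero_add, ← measure_preimage_add volume (-a₀) L]
      refine measure_mono fun x hx => ?_
      have := h a₀ ha₀ (-a₀ + x) (hLB hx)
      simpa using this
    rcases L.eq_empty_or_nonempty with rfl | hL0
    · rw [measure_empty, add_zero, ← measure_preimage_add volume (-b₀) K]
      refine measure_mono fun x hx => ?_
      have := h (-b₀ + x) (hKA hx) b₀ hb₀
      simpa using this
    set k := sSup K
    set l := sInf L
    have hk : k ∈ K := hK.sSup_mem hK0
    have hl : l ∈ L := hL.sInf_mem hL0
    rw [← measure_preimage_add volume (-l) K, ← measure_preimage_add volume (-k) L]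
    have hd : AEDisjoint volume ((fun x => -l + x) ⁻¹' K) ((fun x => -k + x) ⁻¹' L) := by
      refine measure_mono_null (t := {k + l}) ?_ (measure_singleton _)
      rintro x ⟨hx1, hx2⟩
      have h1 := le_csSup hK.bddAbove hx1
      have h2 := csInf_le hL.bddBelow hx2
      rw [mem_singleton_iff]
      change -l + x ≤ k at h1
      change l ≤ -k + x at h2
      linarith
    rw [← measure_union₀ ((hL.measurableSet.preimage (by fun_prop)).nullMeasurableSet) hd]
    refine measure_mono (union_subset ?_ ?_)
    · intro x hx
      have := h _ (hKA hx) l (hLB hl)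
      simpa using this
    · intro x hx
      have := h k (hKA hk) _ (hLB hx)
      simpa using this
  rw [hA.measure_eq_iSup_isCompact, hB.measure_eq_iSup_isCompact]
  simp only [iSup_and']
  exact ENNReal.biSup_add_biSup_le' ⟨∅, by simp⟩ ⟨∅, by simp⟩ key

theorem lintegral_eq_lintegral_measure_ofReal_lt {α : Type*} [MeasurableSpace α] (μ : Measure α)
    {f : α → ℝ≥0∞} (hf : Measurable f) (hfin : ∀ x, f x ≠ ∞) :
    ∫⁻ x, f x ∂μ = ∫⁻ u in Ioi (0 : ℝ), μ {x | ENNReal.ofReal u < f x} := by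
  have h := lintegral_eq_lintegral_meas_lt μ (f := fun x => (f x).toReal)
    (ae_of_all _ fun x => ENNReal.toReal_nonneg) hf.ennreal_toReal.aemeasurable
  simp only [ENNReal.ofReal_toReal (hfin _)] at h
  rw [h]
  refine setLIntegral_congr_fun measurableSet_Ioi fun u hu => ?_
  simp only [ENNReal.ofReal_lt_iff_lt_toReal (le_of_lt hu) (hfin _)]

theorem Real.measurableSet_smul_volume {c : ℝ} (hc : 0 < c) {A : Set ℝ} (hA : MeasurableSet A) :
    MeasurableSet ((fun x => c * x) '' A) ∧
      volume ((fun x => c * x) '' A) = ENNReal.ofReal c * volume A := by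
  have h := Measure.addHaar_smul volume c A
  rw [Module.finrank_self, pow_one, abs_of_pos hc] at h
  exact ⟨hA.const_smul₀ c, h⟩

/-- Since both suprema equal 1, the superlevel sets of f and g at each level u < 1 are nonempty, so
one-dimensional Brunn-Minkowski applies level by level. Integrating over u gives an arithmetic mean,
stronger than the geometric one. -/
theorem prekopa_leindler_normalized {t : ℝ} (ht0 : 0 < t) (ht1 : t < 1) {f g h : ℝ → ℝ≥0∞}
    (hf : Measurable f) (hg : Measurable g) (hh : Measurable h)
    (hf1 : ⨆ x, f x = 1) (hg1 : ⨆ x, g x = 1)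
    (H : ∀ x y, f x ^ (1 - t) * g y ^ t ≤ h ((1 - t) * x + t * y)) :
    ENNReal.ofReal (1 - t) * (∫⁻ x, f x) + ENNReal.ofReal t * (∫⁻ x, g x) ≤ ∫⁻ x, h x := by
  have hs : 0 < 1 - t := by linarith
  have hfle : ∀ x, f x ≤ 1 := fun x => hf1 ▸ le_iSup f x
  have hgle : ∀ x, g x ≤ 1 := fun x => hg1 ▸ le_iSup g x
  -- Truncation makes the function finite, as the layer cake formula requires; only levels u < 1
  -- matter.
  calc _ ≤ ∫⁻ x, min (h x) 1 := ?_
    _ ≤ _ := lintegral_mono fun x => min_le_left _ _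
  have hfm : ∀ {φ : ℝ → ℝ≥0∞}, Measurable φ →
      Measurable fun u : ℝ => volume {x | ENNReal.ofReal u < φ x} := by
    intro φ _
    exact Antitone.measurable fun u v huv => measure_mono fun x hx =>
      lt_of_le_of_lt (ENNReal.ofReal_le_ofReal huv) hx
  rw [lintegral_eq_lintegral_measure_ofReal_lt _ hf fun x => ((hfle x).trans_lt (by simp)).ne,
    lintegral_eq_lintegral_measure_ofReal_lt _ hg fun x => ((hgle x).trans_lt (by simp)).ne,
    lintegral_eq_lintegral_measure_ofReal_lt _ (hh.min measurable_const)
      fun x => ((min_le_right _ _).trans_lt (by simp)).ne,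
    ← lintegral_const_mul _ (hfm hf), ← lintegral_const_mul _ (hfm hg),
    ← lintegral_add_left ((hfm hf).const_mul _)]
  refine setLIntegral_mono' measurableSet_Ioi fun u hu => ?_
  rcases lt_or_ge u 1 with hu1 | hu1
  · have hu1' : ENNReal.ofReal u < 1 := by simpa using hu1
    have hA : MeasurableSet {x | ENNReal.ofReal u < f x} := measurableSet_lt measurable_const hf
    have hB : MeasurableSet {x | ENNReal.ofReal u < g x} := measurableSet_lt measurable_const hg
    obtain ⟨a, ha⟩ := lt_iSup_iff.1 (hf1 ▸ hu1')
    obtain ⟨b, hb⟩ := lt_iSup_iff.1 (hg1 ▸ hu1')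
    obtain ⟨hA1, hA2⟩ := Real.measurableSet_smul_volume hs hA
    obtain ⟨hB1, hB2⟩ := Real.measurableSet_smul_volume ht0 hB
    rw [← hA2, ← hB2]
    refine Real.volume_add_volume_le hA1 hB1 (Set.Nonempty.image _ ⟨a, ha⟩)
      (Set.Nonempty.image _ ⟨b, hb⟩) ?_
    rintro _ ⟨x, hx, rfl⟩ _ ⟨y, hy, rfl⟩
    refine lt_min (lt_of_lt_of_le ?_ (H x y)) hu1'
    have hu0 : ENNReal.ofReal u ≠ 0 := by simpa using hu
    calc ENNReal.ofReal u = ENNReal.ofReal u ^ (1 - t) * ENNReal.ofReal u ^ t := by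
          rw [← ENNReal.rpow_add _ _ hu0 ENNReal.ofReal_ne_top]; simp
      _ < _ := ENNReal.mul_lt_mul (ENNReal.rpow_lt_rpow hx hs) (ENNReal.rpow_lt_rpow hy ht0)
  · have hu1' : 1 ≤ ENNReal.ofReal u := by simpa using hu1
    have e1 : {x | ENNReal.ofReal u < f x} = ∅ :=
      eq_empty_of_forall_notMem fun x hx => absurd (hx.trans_le (hfle x)) (not_lt.2 hu1')
    have e2 : {x | ENNReal.ofReal u < g x} = ∅ :=
      eq_empty_of_forall_notMem fun x hx => absurd (hx.trans_le (hgle x)) (not_lt.2 hu1')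
    rw [e1, e2]; simp

theorem ENNReal.geom_mean_le_arith_mean2 {t : ℝ} (ht0 : 0 < t) (ht1 : t < 1) (a b : ℝ≥0∞) :
    a ^ (1 - t) * b ^ t ≤ ENNReal.ofReal (1 - t) * a + ENNReal.ofReal t * b := by
  have hs : 0 < 1 - t := by linarith
  induction a with
  | top =>
    rw [ENNReal.mul_top (by simpa using hs), top_add]; exact le_top
  | coe a =>
  induction b with
  | top =>
    rw [ENNReal.mul_top (by simpa using ht0), add_top]; exact le_top
  | coe b =>
  have := NNReal.geom_mean_le_arith_mean2_weighted (1 - t).toNNReal t.toNNReal a b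
    (by rw [← Real.toNNReal_add hs.le ht0.le]; simp)
  rw [Real.coe_toNNReal _ hs.le, Real.coe_toNNReal _ ht0.le] at this
  rw [← ENNReal.coe_rpow_of_nonneg _ hs.le, ← ENNReal.coe_rpow_of_nonneg _ ht0.le]
  rw [← ENNReal.coe_mul]
  refine (ENNReal.coe_le_coe.2 this).trans_eq ?_
  rw [ENNReal.coe_add, ENNReal.coe_mul, ENNReal.coe_mul]
  rfl

/-- Divide f and g by their suprema, h by the corresponding geometric mean, and weaken the
normalized conclusion by the AM-GM inequality. -/
theorem prekopa_leindler_bounded {t : ℝ} (ht0 : 0 < t) (ht1 : t < 1) {f g h : ℝ → ℝ≥0∞}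
    (hf : Measurable f) (hg : Measurable g) (hh : Measurable h)
    (hfb : ⨆ x, f x ≠ ∞) (hgb : ⨆ x, g x ≠ ∞)
    (H : ∀ x y, f x ^ (1 - t) * g y ^ t ≤ h ((1 - t) * x + t * y)) :
    (∫⁻ x, f x) ^ (1 - t) * (∫⁻ x, g x) ^ t ≤ ∫⁻ x, h x := by
  have hs : 0 < 1 - t := by linarith
  set M := ⨆ x, f x with hM
  set N := ⨆ x, g x with hN
  rcases eq_or_ne M 0 with hM0 | hM0
  · have : ∀ x, f x = 0 := fun x => le_antisymm (hM0 ▸ le_iSup f x) zero_le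
    simp [this, ENNReal.zero_rpow_of_pos hs]
  rcases eq_or_ne N 0 with hN0 | hN0
  · have : ∀ x, g x = 0 := fun x => le_antisymm (hN0 ▸ le_iSup g x) zero_le
    simp [this, ENNReal.zero_rpow_of_pos ht0]
  set c := M ^ (1 - t) * N ^ t with hc
  have hc0 : c ≠ 0 := mul_ne_zero (by simp [ENNReal.rpow_eq_zero_iff, hM0, hfb])
    (by simp [ENNReal.rpow_eq_zero_iff, hN0, hgb])
  have hct : c ≠ ∞ := ENNReal.mul_ne_top (ENNReal.rpow_ne_top_of_nonneg hs.le hfb)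
    (ENNReal.rpow_ne_top_of_nonneg ht0.le hgb)
  have key := prekopa_leindler_normalized ht0 ht1 (f := fun x => M⁻¹ * f x)
    (g := fun x => N⁻¹ * g x) (h := fun x => c⁻¹ * h x) (hf.const_mul _) (hg.const_mul _)
    (hh.const_mul _) (by rw [← ENNReal.mul_iSup]; exact ENNReal.inv_mul_cancel hM0 hfb)
    (by rw [← ENNReal.mul_iSup]; exact ENNReal.inv_mul_cancel hN0 hgb) (by
      intro x y
      have hcinv : c⁻¹ = M⁻¹ ^ (1 - t) * N⁻¹ ^ t := by
        rw [hc, ENNReal.mul_inv (Or.inr (ENNReal.rpow_ne_top_of_nonneg ht0.le hgb))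
          (Or.inl (ENNReal.rpow_ne_top_of_nonneg hs.le hfb)), ENNReal.inv_rpow, ENNReal.inv_rpow]
      rw [ENNReal.mul_rpow_of_nonneg _ _ hs.le, ENNReal.mul_rpow_of_nonneg _ _ ht0.le, hcinv,
        mul_mul_mul_comm]
      gcongr
      exact H x y)
  rw [lintegral_const_mul _ hf, lintegral_const_mul _ hg, lintegral_const_mul _ hh] at key
  have := (ENNReal.geom_mean_le_arith_mean2 ht0 ht1 _ _).trans key
  rw [ENNReal.mul_rpow_of_nonneg _ _ hs.le, ENNReal.mul_rpow_of_nonneg _ _ ht0.le,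
    mul_mul_mul_comm, ENNReal.inv_rpow, ENNReal.inv_rpow,
    ← ENNReal.mul_inv (Or.inr (ENNReal.rpow_ne_top_of_nonneg ht0.le hgb))
          (Or.inl (ENNReal.rpow_ne_top_of_nonneg hs.le hfb)), ← hc] at this
  rwa [ENNReal.mul_le_mul_iff_right (ENNReal.inv_ne_zero.2 hct) (ENNReal.inv_ne_top.2 hc0)] at this

theorem prekopa_leindler_real {t : ℝ} (ht0 : 0 < t) (ht1 : t < 1) {f g h : ℝ → ℝ≥0∞}
    (hf : Measurable f) (hg : Measurable g) (hh : Measurable h)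
    (H : ∀ x y, f x ^ (1 - t) * g y ^ t ≤ h ((1 - t) * x + t * y)) :
    (∫⁻ x, f x) ^ (1 - t) * (∫⁻ x, g x) ^ t ≤ ∫⁻ x, h x := by
  have hs : 0 < 1 - t := by linarith
  have lim : ∀ {φ : ℝ → ℝ≥0∞}, Measurable φ →
      (∀ j : ℕ, Measurable fun x => min (φ x) j) ∧ (∀ j : ℕ, ⨆ x, min (φ x) j ≠ ∞) ∧
      ⨆ j : ℕ, ∫⁻ x, min (φ x) j = ∫⁻ x, φ x := by
    intro φ hφ
    refine ⟨fun j => hφ.min measurable_const, fun j => ne_top_of_le_ne_top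
      (ENNReal.natCast_ne_top j) (iSup_le fun x => min_le_right _ _), ?_⟩
    rw [← lintegral_iSup (fun j => hφ.min measurable_const)
      (fun i j hij x => min_le_min le_rfl (by exact_mod_cast hij))]
    congr 1; ext x
    rw [← inf_iSup_eq, ENNReal.iSup_natCast, inf_top_eq]
  obtain ⟨f1, f2, f3⟩ := lim hf
  obtain ⟨g1, g2, g3⟩ := lim hg
  have mono : ∀ (φ : ℝ → ℝ≥0∞), Monotone fun j : ℕ => ∫⁻ x, min (φ x) j := fun φ i j hij =>
    lintegral_mono fun x => min_le_min le_rfl (by exact_mod_cast hij)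
  have key : ∀ j : ℕ, (∫⁻ x, min (f x) j) ^ (1 - t) * (∫⁻ x, min (g x) j) ^ t ≤ ∫⁻ x, h x := by
    intro j
    refine prekopa_leindler_bounded ht0 ht1 (f1 j) (g1 j) hh (f2 j) (g2 j) fun x y => ?_
    refine le_trans ?_ (H x y)
    gcongr <;> exact min_le_left _ _
  have tf := tendsto_atTop_iSup (mono f)
  have tg := tendsto_atTop_iSup (mono g)
  rw [f3] at tf
  rw [g3] at tg
  rcases eq_or_ne (∫⁻ x, f x) 0 with hf0 | hf0
  · simp [hf0, ENNReal.zero_rpow_of_pos hs]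
  rcases eq_or_ne (∫⁻ x, g x) 0 with hg0 | hg0
  · simp [hg0, ENNReal.zero_rpow_of_pos ht0]
  have tf' := (ENNReal.continuous_rpow_const (y := 1 - t)).continuousAt.tendsto.comp tf
  have tg' := (ENNReal.continuous_rpow_const (y := t)).continuousAt.tendsto.comp tg
  have hf0' : (∫⁻ x, f x) ^ (1 - t) ≠ 0 := by
    simp [ENNReal.rpow_eq_zero_iff, hf0, hs.not_gt]
  have hg0' : (∫⁻ x, g x) ^ t ≠ 0 := by
    simp [ENNReal.rpow_eq_zero_iff, hg0, ht0.not_gt]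
  exact le_of_tendsto (ENNReal.Tendsto.mul tf' (Or.inl hf0') tg' (Or.inl hg0'))
    (Eventually.of_forall key)

/-- Induction by Fubini: by the inequality in dimension n, the integrals over slices satisfy the
hypothesis of the one-dimensional case. -/
theorem prekopa_leindler {t : ℝ} (ht0 : 0 < t) (ht1 : t < 1) (n : ℕ)
    {f g h : (Fin n → ℝ) → ℝ≥0∞} (hf : Measurable f) (hg : Measurable g) (hh : Measurable h)
    (H : ∀ x y, f x ^ (1 - t) * g y ^ t ≤ h ((1 - t) • x + t • y)) :
    (∫⁻ x, f x) ^ (1 - t) * (∫⁻ x, g x) ^ t ≤ ∫⁻ x, h x := by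
  induction n with
  | zero =>
    rw [Measure.volume_pi_eq_dirac (0 : Fin 0 → ℝ)]
    simp only [lintegral_dirac]
    exact (H 0 0).trans_eq (by congr 1; exact Subsingleton.elim _ _)
  | succ n ih =>
    have fub : ∀ φ : (Fin (n + 1) → ℝ) → ℝ≥0∞, Measurable φ →
        (∀ a : ℝ, Measurable fun z : Fin n → ℝ => φ (Fin.cons a z)) ∧
        Measurable (fun a : ℝ => ∫⁻ z : Fin n → ℝ, φ (Fin.cons a z)) ∧
        ∫⁻ x, φ x = ∫⁻ a : ℝ, ∫⁻ z : Fin n → ℝ, φ (Fin.cons a z) := by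
      intro φ hφ
      have e := (volume_preserving_piFinSuccAbove (fun _ : Fin (n + 1) => ℝ) 0).symm
      have he : ∀ p : ℝ × (Fin n → ℝ), (MeasurableEquiv.piFinSuccAbove
          (fun _ : Fin (n + 1) => ℝ) 0).symm p = Fin.cons p.1 p.2 := fun p =>
        Fin.insertNth_zero (α := fun _ => ℝ) p.1 p.2
      have hm : Measurable fun p : ℝ × (Fin n → ℝ) => φ (Fin.cons p.1 p.2) := by
        have := hφ.comp e.measurable
        simpa only [Function.comp_def, he] using this
      refine ⟨fun a => hm.comp (g := fun p : ℝ × (Fin n → ℝ) => φ (Fin.cons p.1 p.2))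
        (measurable_const.prodMk measurable_id), hm.lintegral_prod_right', ?_⟩
      rw [← e.lintegral_comp hφ]
      simp only [he]
      rw [Measure.volume_eq_prod, lintegral_prod _ hm.aemeasurable]
    obtain ⟨f1, f2, f3⟩ := fub f hf
    obtain ⟨g1, g2, g3⟩ := fub g hg
    obtain ⟨h1, h2, h3⟩ := fub h hh
    rw [f3, g3, h3]
    refine prekopa_leindler_real ht0 ht1 f2 g2 h2 fun a b => ?_
    refine ih (f1 a) (g1 b) (h1 _) fun x y => ?_
    refine (H (Fin.cons a x) (Fin.cons b y)).trans_eq ?_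
    congr 1
    ext i
    refine Fin.cases ?_ (fun i => ?_) i <;> simp

theorem prekopa_leindler_euclideanSpace {t : ℝ} (ht0 : 0 < t) (ht1 : t < 1) (n : ℕ)
    {f g h : EuclideanSpace ℝ (Fin n) → ℝ≥0∞}
    (hf : Measurable f) (hg : Measurable g) (hh : Measurable h)
    (H : ∀ x y, f x ^ (1 - t) * g y ^ t ≤ h ((1 - t) • x + t • y)) :
    (∫⁻ x, f x) ^ (1 - t) * (∫⁻ x, g x) ^ t ≤ ∫⁻ x, h x := by
  have e := EuclideanSpace.volume_preserving_symm_measurableEquiv_toLp (Fin n)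
  have e' := e.symm
  rw [← e'.lintegral_comp hf, ← e'.lintegral_comp hg, ← e'.lintegral_comp hh]
  exact prekopa_leindler ht0 ht1 n (hf.comp e'.measurable) (hg.comp e'.measurable)
    (hh.comp e'.measurable) fun x y => H _ _

/-- Prékopa-Leindler for the indicators of α⁻¹A, β⁻¹B and (α+β)⁻¹C, where α and β are the N-th roots
of the volumes of A and B, so that the first two sets have volume 1. -/
theorem brunn_minkowski {N : ℕ} (hN : 0 < N) {A B C : Set (EuclideanSpace ℝ (Fin N))}
    (hA : MeasurableSet A) (hB : MeasurableSet B) (hC : MeasurableSet C)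
    (hA0 : volume A ≠ 0) (hB0 : volume B ≠ 0) (hAt : volume A ≠ ∞) (hBt : volume B ≠ ∞)
    (H : ∀ a ∈ A, ∀ b ∈ B, a + b ∈ C) :
    volume A ^ (N : ℝ)⁻¹ + volume B ^ (N : ℝ)⁻¹ ≤ volume C ^ (N : ℝ)⁻¹ := by
  have hNr : (0 : ℝ) < N := by exact_mod_cast hN
  have root : ∀ {v : ℝ≥0∞}, v ≠ 0 → v ≠ ∞ → ∃ α : ℝ, 0 < α ∧ ENNReal.ofReal α = v ^ (N : ℝ)⁻¹ ∧
      ENNReal.ofReal |(α ^ N)⁻¹| * v = 1 := by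
    intro v h0 ht
    have ht' : v ^ (N : ℝ)⁻¹ ≠ ∞ := ENNReal.rpow_ne_top_of_nonneg (by positivity) ht
    have h0' : v ^ (N : ℝ)⁻¹ ≠ 0 := by
      simp [ENNReal.rpow_eq_zero_iff, h0, hNr.le]
    have hpos : 0 < (v ^ (N : ℝ)⁻¹).toReal := ENNReal.toReal_pos h0' ht'
    refine ⟨(v ^ (N : ℝ)⁻¹).toReal, hpos, ENNReal.ofReal_toReal ht', ?_⟩
    rw [abs_of_pos (by positivity), ENNReal.ofReal_inv_of_pos (by positivity),
      ENNReal.ofReal_pow hpos.le, ENNReal.ofReal_toReal ht', ← ENNReal.rpow_natCast, ENNReal.rpow_inv_rpow hNr.ne',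
      ENNReal.inv_mul_cancel h0 ht]
  obtain ⟨α, hα, hα1, hα2⟩ := root hA0 hAt
  obtain ⟨β, hβ, hβ1, hβ2⟩ := root hB0 hBt
  -- With this weight, (α+β)((1-t)x + ty) = αx + βy.
  set t := β / (α + β)
  have ht0 : 0 < t := by positivity
  have ht1 : t < 1 := by rw [div_lt_one (by positivity)]; linarith
  have hpre : ∀ (c : ℝ), 0 < c → ∀ {D : Set (EuclideanSpace ℝ (Fin N))}, MeasurableSet D →
      Measurable (((fun x => c • x) ⁻¹' D).indicator (fun _ => (1 : ℝ≥0∞))) ∧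
      ∫⁻ x, ((fun x => c • x) ⁻¹' D).indicator (fun _ => (1 : ℝ≥0∞)) x =
        ENNReal.ofReal |(c ^ N)⁻¹| * volume D := by
    intro c hc D hD
    have hm : MeasurableSet ((fun x : EuclideanSpace ℝ (Fin N) => c • x) ⁻¹' D) :=
      hD.preimage (measurable_const_smul c)
    refine ⟨measurable_const.indicator hm, ?_⟩
    rw [lintegral_indicator hm, setLIntegral_one, Measure.addHaar_preimage_smul _ hc.ne',
      finrank_euclideanSpace_fin]
  obtain ⟨f1, f2⟩ := hpre α hα hA
  obtain ⟨g1, g2⟩ := hpre β hβ hB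
  obtain ⟨h1, h2⟩ := hpre (α + β) (by positivity) hC
  have key := prekopa_leindler_euclideanSpace ht0 ht1 N f1 g1 h1 fun x y => ?_
  · rw [f2, g2, h2, hα2, hβ2, ENNReal.one_rpow, ENNReal.one_rpow, one_mul,
      abs_of_pos (by positivity), ENNReal.ofReal_inv_of_pos (by positivity),
      ENNReal.ofReal_pow (by positivity)] at key
    rw [← hα1, ← hβ1, ← ENNReal.ofReal_add hα.le hβ.le, ENNReal.le_rpow_inv_iff hNr,
      ENNReal.rpow_natCast]
    rwa [mul_comm, ← div_eq_mul_inv, ENNReal.le_div_iff_mul_le, one_mul] at key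
    · left; simpa using fun h : α + β ≤ 0 => absurd h (not_le.2 (by positivity))
    · left; exact ENNReal.pow_ne_top ENNReal.ofReal_ne_top
  · by_cases hx : α • x ∈ A
    · by_cases hy : β • y ∈ B
      · have : (α + β) • ((1 - t) • x + t • y) ∈ C := by
          convert H _ hx _ hy using 1
          rw [smul_add, smul_smul, smul_smul]
          congr 2 <;> simp only [t] <;> field_simp; ring
        simp only [indicator, mem_preimage, hx, hy, this, if_true, ENNReal.one_rpow, mul_one, le_refl]
      · simp [indicator, hy, ENNReal.zero_rpow_of_pos ht0]
    · simp [indicator, hx, ENNReal.zero_rpow_of_pos (sub_pos.2 ht1)]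

/-! ### Lower densities and differentiation of measures -/

section LowerDensity

variable {V : Type*} [NormedAddCommGroup V] [MeasurableSpace V]

/-- The lower density of `ν` with respect to `lam`, along closed balls. -/
noncomputable def lowerDensity (ν lam : Measure V) (x : V) : ℝ≥0∞ :=
  liminf (fun r => ν (Metric.closedBall x r) / lam (Metric.closedBall x r)) (𝓝[>] (0 : ℝ))

/-- Allows D to be replaced by numbers p below it, to which a liminf can be compared. The value p =
0 is admitted because nothing is smaller than D when D = 0. -/
theorem ENNReal.apply_le_of_forall_lt_or_eq_zero {φ : ℝ≥0∞ → ℝ≥0∞} (hφ : Continuous φ)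
    {c D : ℝ≥0∞} (h : ∀ p, p < D ∨ p = 0 → φ p ≤ c) : φ D ≤ c := by
  rcases eq_or_ne D 0 with rfl | hD
  · exact h 0 (Or.inr rfl)
  · have hcl : IsClosed {p | φ p ≤ c} := isClosed_le hφ continuous_const
    have : closure (Iio D) ⊆ {p | φ p ≤ c} :=
      hcl.closure_subset_iff.2 fun p hp => h p (Or.inl hp)
    rw [closure_Iio' ⟨0, pos_iff_ne_zero.2 hD⟩] at this
    exact this (mem_Iic.2 le_rfl)

theorem eventually_lt_of_lt_lowerDensity {ν lam : Measure V} {x : V} {p : ℝ≥0∞}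
    (hp : p < lowerDensity ν lam x ∨ p = 0) :
    ∀ᶠ r in 𝓝[>] (0 : ℝ), p ≤ ν (Metric.closedBall x r) / lam (Metric.closedBall x r) := by
  rcases hp with hp | rfl
  · exact (eventually_lt_of_lt_liminf hp).mono fun r hr => hr.le
  · exact Eventually.of_forall fun r => zero_le

theorem tendsto_const_mul_nhdsGT_zero {c : ℝ} (hc : 0 < c) :
    Tendsto (fun r => c * r) (𝓝[>] (0 : ℝ)) (𝓝[>] 0) := by
  refine tendsto_nhdsWithin_iff.2 ⟨?_, ?_⟩
  · have : Tendsto (fun r : ℝ => c * r) (𝓝 0) (𝓝 (c * 0)) := (continuous_const_mul c).tendsto 0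
    rw [mul_zero] at this
    exact this.mono_left nhdsWithin_le_nhds
  · filter_upwards [self_mem_nhdsWithin] with r hr using mul_pos hc hr

theorem eventually_const_mul_nhdsGT_zero_iff {c : ℝ} (hc : 0 < c) {P : ℝ → Prop} :
    (∀ᶠ r in 𝓝[>] (0 : ℝ), P (c * r)) ↔ ∀ᶠ r in 𝓝[>] (0 : ℝ), P r := by
  refine ⟨fun h => ?_, fun h => (tendsto_const_mul_nhdsGT_zero hc).eventually h⟩
  have := (tendsto_const_mul_nhdsGT_zero (inv_pos.2 hc)).eventually h
  simpa [mul_inv_cancel_left₀ hc.ne'] using this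

theorem lowerDensity_eq_zero {ν lam : Measure V} {K : Set V} (hK : IsClosed K) (h0 : ν Kᶜ = 0) {x : V} (hx : x ∉ K) :
    lowerDensity ν lam x = 0 := by
  obtain ⟨ε, hε, hb⟩ := Metric.isOpen_iff.1 hK.isOpen_compl x hx
  refine (liminf_congr (v := fun _ => (0 : ℝ≥0∞)) ?_).trans (by simp)
  filter_upwards [Ioo_mem_nhdsGT hε] with r hr
  rw [measure_mono_null ((Metric.closedBall_subset_ball hr.2).trans hb) h0, ENNReal.zero_div]

variable [NormedSpace ℝ V] [FiniteDimensional ℝ V] [BorelSpace V]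

variable (lam : Measure V) [lam.IsAddHaarMeasure] (ν : Measure V)

theorem addHaar_closedBall_mul_eq {a r : ℝ} (ha : 0 < a) (hr : 0 < r) (x : V) :
    lam (Metric.closedBall x (a * r)) =
      ENNReal.ofReal a ^ Module.finrank ℝ V * lam (Metric.closedBall (0 : V) r) := by
  rw [Measure.addHaar_closedBall _ _ (by positivity), Measure.addHaar_closedBall _ _ hr.le,
    mul_pow, ENNReal.ofReal_mul (by positivity), ENNReal.ofReal_pow ha.le, mul_assoc]

/-- Apply the inequality to the radii ar, br, Rr and divide by the N-th root of the Lebesgue measure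
of a ball of radius r. The free choice of a and b is what later yields the sharp exponent. -/
theorem lowerDensity_superadditive {N : ℕ} (hN : 0 < N) {x y : V}
    (hBM : ∀ a b R : ℝ, 0 < a → 0 < b → a + b < R →
      ν (Metric.closedBall x a) ^ (N : ℝ)⁻¹ + ν (Metric.closedBall y b) ^ (N : ℝ)⁻¹ ≤
        ν (Metric.closedBall (x + y) R) ^ (N : ℝ)⁻¹)
    {a b R : ℝ} (ha : 0 < a) (hb : 0 < b) (hR : a + b < R) :
    (ENNReal.ofReal a ^ Module.finrank ℝ V * lowerDensity ν lam x) ^ (N : ℝ)⁻¹ +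
      (ENNReal.ofReal b ^ Module.finrank ℝ V * lowerDensity ν lam y) ^ (N : ℝ)⁻¹ ≤
      (ENNReal.ofReal R ^ Module.finrank ℝ V * lowerDensity ν lam (x + y)) ^ (N : ℝ)⁻¹ := by
  set d := Module.finrank ℝ V
  have hNr : (0 : ℝ) < N := by exact_mod_cast hN
  have hRp : 0 < R := by linarith
  have hRd0 : ENNReal.ofReal R ^ d ≠ 0 := pow_ne_zero _ (by simpa using hRp)
  have hRdt : ENNReal.ofReal R ^ d ≠ ∞ := ENNReal.pow_ne_top ENNReal.ofReal_ne_top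
  have step : ∀ p, p < lowerDensity ν lam x ∨ p = 0 → ∀ q, q < lowerDensity ν lam y ∨ q = 0 →
      (ENNReal.ofReal a ^ d * p) ^ (N : ℝ)⁻¹ + (ENNReal.ofReal b ^ d * q) ^ (N : ℝ)⁻¹ ≤
      (ENNReal.ofReal R ^ d * lowerDensity ν lam (x + y)) ^ (N : ℝ)⁻¹ := by
    intro p hp q hq
    rw [ENNReal.le_rpow_inv_iff hNr, mul_comm (ENNReal.ofReal R ^ d),
      ← ENNReal.div_le_iff hRd0 hRdt]
    refine le_liminf_of_le (by isBoundedDefault) ?_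
    rw [← eventually_const_mul_nhdsGT_zero_iff hRp]
    filter_upwards [(eventually_const_mul_nhdsGT_zero_iff ha).2 (eventually_lt_of_lt_lowerDensity hp),
      (eventually_const_mul_nhdsGT_zero_iff hb).2 (eventually_lt_of_lt_lowerDensity hq),
      self_mem_nhdsWithin] with r hr1 hr2 hr
    have hr : 0 < r := hr
    have hs0 : lam (Metric.closedBall (0 : V) r) ≠ 0 :=
      (Metric.measure_closedBall_pos _ _ hr).ne'
    have hst : lam (Metric.closedBall (0 : V) r) ≠ ∞ := measure_closedBall_lt_top.ne
    have h := hBM (a * r) (b * r) (R * r) (by positivity) (by positivity)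
      (by rw [← add_mul]; gcongr)
    rw [addHaar_closedBall_mul_eq lam ha hr] at hr1
    rw [addHaar_closedBall_mul_eq lam hb hr] at hr2
    rw [addHaar_closedBall_mul_eq lam hRp hr]
    set s := lam (Metric.closedBall (0 : V) r)
    have hpos : ∀ {c : ℝ}, 0 < c → ENNReal.ofReal c ^ d * s ≠ 0 := fun hc =>
      mul_ne_zero (pow_ne_zero _ (by simpa using hc)) hs0
    have htop : ∀ {c : ℝ}, ENNReal.ofReal c ^ d * s ≠ ∞ := fun {c} =>
      ENNReal.mul_ne_top (ENNReal.pow_ne_top ENNReal.ofReal_ne_top) hst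
    rw [ENNReal.le_div_iff_mul_le (Or.inl (hpos ha)) (Or.inl htop)] at hr1
    rw [ENNReal.le_div_iff_mul_le (Or.inl (hpos hb)) (Or.inl htop)] at hr2
    rw [ENNReal.div_le_iff hRd0 hRdt, ← ENNReal.le_rpow_inv_iff hNr]
    have hi : (0 : ℝ) ≤ (N : ℝ)⁻¹ := by positivity
    have hsi0 : s ^ (N : ℝ)⁻¹ ≠ 0 := by
      simp [ENNReal.rpow_eq_zero_iff, hs0, hNr.le]
    have hsit : s ^ (N : ℝ)⁻¹ ≠ ∞ := ENNReal.rpow_ne_top_of_nonneg hi hst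
    rw [← ENNReal.mul_le_mul_iff_left hsi0 hsit, add_mul, ← ENNReal.mul_rpow_of_nonneg _ _ hi,
      ← ENNReal.mul_rpow_of_nonneg _ _ hi, ← ENNReal.mul_rpow_of_nonneg _ _ hi]
    refine le_trans (add_le_add (ENNReal.rpow_le_rpow ?_ hi) (ENNReal.rpow_le_rpow ?_ hi))
      (h.trans_eq ?_)
    · refine le_trans (le_of_eq ?_) hr1; ring
    · refine le_trans (le_of_eq ?_) hr2; ring
    · congr 1
      rw [mul_assoc, ENNReal.div_mul_cancel (hpos hRp) htop]
  have cont : ∀ c : ℝ, Continuous fun p : ℝ≥0∞ => (ENNReal.ofReal c ^ d * p) ^ (N : ℝ)⁻¹ :=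
    fun c => ENNReal.continuous_rpow_const.comp
      (ENNReal.continuous_const_mul (ENNReal.pow_ne_top ENNReal.ofReal_ne_top))
  refine ENNReal.apply_le_of_forall_lt_or_eq_zero (φ := fun p => _ + _)
    ((cont a).add continuous_const) fun p hp => ?_
  exact ENNReal.apply_le_of_forall_lt_or_eq_zero
    (φ := fun q => (ENNReal.ofReal a ^ d * p) ^ (N : ℝ)⁻¹ + (ENNReal.ofReal b ^ d * q) ^ (N : ℝ)⁻¹)
    (continuous_const.add (cont b)) fun q hq => step p hp q hq

/-- Dilating a ball by c multiplies its ν-measure by c^(d+m) and its Lebesgue measure by c^d. One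
inequality suffices, applied to c and to c⁻¹. -/
theorem lowerDensity_smul {m : ℕ}
    (hhom : ∀ c : ℝ, 0 < c → ∀ x r, ν (Metric.closedBall (c • x) (c * r)) =
      ENNReal.ofReal c ^ (Module.finrank ℝ V + m) * ν (Metric.closedBall x r))
    {c : ℝ} (hc : 0 < c) (x : V) :
    lowerDensity ν lam (c • x) = ENNReal.ofReal c ^ m * lowerDensity ν lam x := by
  have ge : ∀ c : ℝ, 0 < c → ∀ x : V,
      ENNReal.ofReal c ^ m * lowerDensity ν lam x ≤ lowerDensity ν lam (c • x) := by
    intro c hc x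
    refine ENNReal.apply_le_of_forall_lt_or_eq_zero (φ := fun p => ENNReal.ofReal c ^ m * p)
      (ENNReal.continuous_const_mul (ENNReal.pow_ne_top ENNReal.ofReal_ne_top)) fun p hp => ?_
    refine le_liminf_of_le (by isBoundedDefault) ?_
    rw [← eventually_const_mul_nhdsGT_zero_iff hc]
    filter_upwards [eventually_lt_of_lt_lowerDensity hp, self_mem_nhdsWithin] with r hr1 hr
    have hr : 0 < r := hr
    have hc0 : ENNReal.ofReal c ^ Module.finrank ℝ V ≠ 0 := pow_ne_zero _ (by simpa using hc)
    have hct : ENNReal.ofReal c ^ Module.finrank ℝ V ≠ ∞ :=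
      ENNReal.pow_ne_top ENNReal.ofReal_ne_top
    rw [hhom c hc, addHaar_closedBall_mul_eq lam hc hr, ← Measure.addHaar_closedBall_center lam x,
      pow_add, mul_assoc, ENNReal.mul_div_mul_left _ _ hc0 hct, mul_div_assoc]
    gcongr
  refine le_antisymm ?_ (ge c hc x)
  have h := ge c⁻¹ (inv_pos.2 hc) (c • x)
  rw [inv_smul_smul₀ hc.ne'] at h
  calc lowerDensity ν lam (c • x)
      = ENNReal.ofReal c ^ m * (ENNReal.ofReal c⁻¹ ^ m * lowerDensity ν lam (c • x)) := by
        rw [← mul_assoc, ← mul_pow, ← ENNReal.ofReal_mul hc.le, mul_inv_cancel₀ hc.ne']; simp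
    _ ≤ _ := by gcongr

variable {lam ν}

theorem lowerDensity_ae_eq_rnDeriv [IsLocallyFiniteMeasure ν] :
    lowerDensity ν lam =ᵐ[lam] ν.rnDeriv lam := by
  filter_upwards [Besicovitch.ae_tendsto_rnDeriv ν lam] with x hx using hx.liminf_eq

/-- Differentiate the other way round: on a `lam`-null set the derivative of `lam` along ν vanishes
ν-almost everywhere, so there the density of ν would be infinite. -/
theorem absolutelyContinuous_of_lowerDensity_ne_top [IsLocallyFiniteMeasure ν] {K : Set V}
    (h0 : ν Kᶜ = 0) (hfin : ∀ x ∈ K, lowerDensity ν lam x ≠ ∞) : ν ≪ lam := by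
  refine Measure.AbsolutelyContinuous.mk fun s hs hs0 => ?_
  have h1 : ∫⁻ x in s, lam.rnDeriv ν x ∂ν = 0 :=
    le_antisymm ((Measure.setLIntegral_rnDeriv_le s).trans_eq hs0) zero_le
  rw [lintegral_eq_zero_iff (Measure.measurable_rnDeriv _ _), EventuallyEq,
    ae_restrict_iff' hs] at h1
  have h2 : ∀ᵐ x ∂ν, x ∈ K := h0
  have : ∀ᵐ x ∂ν, x ∉ s := by
    filter_upwards [h1, h2, Besicovitch.ae_tendsto_rnDeriv lam ν] with x hx hxK hlim hxs
    refine hfin x hxK ?_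
    rw [hx hxs] at hlim
    have := (continuous_inv.tendsto _).comp hlim
    simp only [Pi.zero_apply, ENNReal.inv_zero] at this
    refine (this.congr' ?_).liminf_eq
    filter_upwards [self_mem_nhdsWithin] with r hr
    exact ENNReal.inv_div (Or.inr measure_closedBall_lt_top.ne)
      (Or.inr (Metric.measure_closedBall_pos _ _ hr).ne')
  exact measure_eq_zero_iff_ae_notMem.2 this

theorem eq_withDensity_lowerDensity [IsLocallyFiniteMeasure ν] {K : Set V}
    (h0 : ν Kᶜ = 0) (hfin : ∀ x ∈ K, lowerDensity ν lam x ≠ ∞) :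
    ν = lam.withDensity (lowerDensity ν lam) := by
  rw [withDensity_congr_ae lowerDensity_ae_eq_rnDeriv]
  exact (Measure.withDensity_rnDeriv_eq _ _
    (absolutelyContinuous_of_lowerDensity_ne_top h0 hfin)).symm

end LowerDensity

/-! ### Cones and concave homogeneous functions -/

/-- A set stable under addition and under multiplication by positive scalars. -/
structure IsCone {V : Type*} [AddCommGroup V] [Module ℝ V] (K : Set V) : Prop where
  add : ∀ x ∈ K, ∀ y ∈ K, x + y ∈ K
  smul : ∀ x ∈ K, ∀ c : ℝ, 0 < c → c • x ∈ K

namespace IsCone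

variable {V : Type*} [NormedAddCommGroup V] [NormedSpace ℝ V] {K : Set V}

theorem convex (hK : IsCone K) : Convex ℝ K := by
  intro x hx y hy a b ha hb hab
  rcases ha.eq_or_lt with rfl | ha
  · rw [zero_add] at hab; subst hab; simpa using hy
  rcases hb.eq_or_lt with rfl | hb
  · rw [add_zero] at hab; subst hab; simpa using hx
  exact hK.add _ (hK.smul x hx a ha) _ (hK.smul y hy b hb)

theorem add_interior (hK : IsCone K) {x y : V} (hx : x ∈ K) (hy : y ∈ interior K) :
    x + y ∈ interior K := by
  have : IsOpen ((fun z => -x + z) ⁻¹' interior K) :=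
    isOpen_interior.preimage (continuous_const.add continuous_id)
  refine interior_maximal (s := K) (t := (fun z => -x + z) ⁻¹' interior K) ?_ this ?_
  · intro z hz
    have := hK.add x hx _ (interior_subset hz)
    simpa using this
  · simpa using hy

theorem smul_interior (hK : IsCone K) {x : V} (hx : x ∈ interior K) {c : ℝ} (hc : 0 < c) :
    c • x ∈ interior K := by
  have : IsOpen ((fun z => c⁻¹ • z) ⁻¹' interior K) :=
    isOpen_interior.preimage (continuous_const_smul _)
  refine interior_maximal (s := K) (t := (fun z => c⁻¹ • z) ⁻¹' interior K) ?_ this ?_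
  · intro z hz
    have := hK.smul _ (interior_subset hz) c hc
    simpa [smul_smul, mul_inv_cancel₀ hc.ne'] using this
  · simpa [smul_smul, inv_mul_cancel₀ hc.ne'] using hx

theorem exists_pos_sub_smul_mem {y : V} (hy : y ∈ interior K) (x : V) :
    ∃ ε : ℝ, 0 < ε ∧ y - ε • x ∈ K := by
  have hc : Tendsto (fun ε : ℝ => y - ε • x) (𝓝[>] 0) (𝓝 y) := by
    have : Continuous fun ε : ℝ => y - ε • x := by fun_prop
    have := this.tendsto 0
    rw [zero_smul, sub_zero] at this
    exact this.mono_left nhdsWithin_le_nhds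
  obtain ⟨ε, h1, h2⟩ := ((hc.eventually (mem_interior_iff_mem_nhds.1 hy)).and
    self_mem_nhdsWithin).exists
  exact ⟨ε, h2, h1⟩

end IsCone

/-- Nonnegative, superadditive and positively homogeneous functions on a cone; equivalently,
nonnegative `1`-homogeneous concave functions. -/
structure IsConcaveHomogeneous {V : Type*} [AddCommGroup V] [Module ℝ V] (K : Set V)
    (g : V → ℝ) : Prop where
  nonneg : ∀ x ∈ K, 0 ≤ g x
  add_le : ∀ x ∈ K, ∀ y ∈ K, g x + g y ≤ g (x + y)
  smul : ∀ x ∈ K, ∀ c : ℝ, 0 < c → g (c • x) = c * g x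

namespace IsConcaveHomogeneous

variable {V : Type*} [NormedAddCommGroup V] [NormedSpace ℝ V] {K : Set V} {g : V → ℝ}

theorem concaveOn (hK : IsCone K) (hg : IsConcaveHomogeneous K g) : ConcaveOn ℝ K g := by
  refine ⟨hK.convex, ?_⟩
  intro x hx y hy a b ha hb hab
  rcases ha.eq_or_lt with rfl | ha
  · rw [zero_add] at hab; subst hab; simp
  rcases hb.eq_or_lt with rfl | hb
  · rw [add_zero] at hab; subst hab; simp
  have := hg.add_le _ (hK.smul x hx a ha) _ (hK.smul y hy b hb)
  rwa [hg.smul x hx a ha, hg.smul y hy b hb] at this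

/-- The upper semicontinuous regularization of a concave homogeneous function. -/
theorem exists_upperSemicontinuousOn [FiniteDimensional ℝ V] (hK : IsCone K)
    (hne : (interior K).Nonempty) (hg : IsConcaveHomogeneous K g) :
    ∃ G : V → ℝ, IsConcaveHomogeneous K G ∧ UpperSemicontinuousOn G K ∧
      ContinuousOn G (interior K) ∧ ∀ x ∈ interior K, G x = g x := by
  obtain ⟨p, hp⟩ := hne
  have hpK := interior_subset hp
  have hcont : ContinuousOn g (interior K) := (hg.concaveOn hK).continuousOn_interior
  have hmem : ∀ x ∈ K, ∀ t : ℝ, 0 < t → x + t • p ∈ interior K := fun x hx t ht =>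
    hK.add_interior hx (hK.smul_interior hp ht)
  have hmono : ∀ x ∈ K, ∀ s t : ℝ, 0 < s → s ≤ t → g (x + s • p) ≤ g (x + t • p) := by
    intro x hx s t hs hst
    rcases hst.eq_or_lt with rfl | hst
    · exact le_rfl
    have hd : 0 < t - s := sub_pos.2 hst
    have h1 := hg.add_le _ (interior_subset (hmem x hx s hs)) _ (hK.smul p hpK _ hd)
    have h2 := hg.nonneg _ (hK.smul p hpK _ hd)
    rw [add_assoc, ← add_smul, add_sub_cancel] at h1
    linarith
  have : Nonempty (Ioi (0 : ℝ)) := ⟨⟨1, mem_Ioi.2 one_pos⟩⟩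
  -- Superadditivity and nonnegativity make g(x + tp) nondecreasing in t, so the infimum is the
  -- limit as t tends to 0. All points x + tp are interior, where g is continuous; an infimum of
  -- continuous functions is upper semicontinuous.
  set G : V → ℝ := fun x => ⨅ t : Ioi (0 : ℝ), g (x + (t : ℝ) • p)
  have hbdd : ∀ x ∈ K, BddBelow (range fun t : Ioi (0 : ℝ) => g (x + (t : ℝ) • p)) := by
    rintro x hx
    refine ⟨0, ?_⟩
    rintro _ ⟨t, rfl⟩
    exact hg.nonneg _ (interior_subset (hmem x hx t t.2))
  have hGle : ∀ x ∈ K, ∀ t : ℝ, 0 < t → G x ≤ g (x + t • p) := fun x hx t ht =>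
    ciInf_le (hbdd x hx) ⟨t, ht⟩
  have hGeq : ∀ x ∈ interior K, G x = g x := by
    intro x hx
    have hxK := interior_subset hx
    have hlim : Tendsto (fun t : ℝ => g (x + t • p)) (𝓝[>] 0) (𝓝 (g x)) := by
      have h1 : Continuous fun t : ℝ => x + t • p := by fun_prop
      have h2 := h1.tendsto 0
      rw [zero_smul, add_zero] at h2
      exact ((hcont.continuousAt (isOpen_interior.mem_nhds hx)).tendsto.comp h2).mono_left
        nhdsWithin_le_nhds
    refine le_antisymm ?_ (le_ciInf fun t => ?_)
    · refine ge_of_tendsto hlim ?_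
      filter_upwards [self_mem_nhdsWithin] with t ht using hGle x hxK t ht
    · refine le_of_tendsto hlim ?_
      filter_upwards [Ioo_mem_nhdsGT t.2] with s hs using hmono x hxK s t hs.1 hs.2.le
  refine ⟨G, ⟨fun x hx => le_ciInf fun t => hg.nonneg _ (interior_subset (hmem x hx t t.2)),
    fun x hx y hy => le_ciInf fun t => ?_, fun x hx c hc => ?_⟩, ?_, ?_, hGeq⟩
  · have ht : 0 < (t : ℝ) / 2 := half_pos t.2
    have h1 := hg.add_le _ (interior_subset (hmem x hx _ ht)) _ (interior_subset (hmem y hy _ ht))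
    rw [add_add_add_comm, ← add_smul, add_halves] at h1
    linarith [hGle x hx _ ht, hGle y hy _ ht]
  · have ge : ∀ x ∈ K, ∀ c : ℝ, 0 < c → c * G x ≤ G (c • x) := by
      intro x hx c hc
      refine le_ciInf fun t => ?_
      have ht : 0 < (t : ℝ) / c := div_pos t.2 hc
      have := hg.smul _ (interior_subset (hmem x hx _ ht)) c hc
      rw [smul_add, smul_smul, mul_div_cancel₀ _ hc.ne'] at this
      rw [this]
      exact mul_le_mul_of_nonneg_left (hGle x hx _ ht) hc.le
    refine le_antisymm ?_ (ge x hx c hc)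
    have := ge _ (hK.smul x hx c hc) c⁻¹ (inv_pos.2 hc)
    rw [inv_smul_smul₀ hc.ne'] at this
    rwa [inv_mul_le_iff₀ hc] at this
  · intro x hx y hy
    obtain ⟨t, ht⟩ := exists_lt_of_ciInf_lt hy
    have hc : ContinuousAt (fun z => g (z + (t : ℝ) • p)) x :=
      ContinuousAt.comp (f := fun z => z + (t : ℝ) • p)
        (hcont.continuousAt (isOpen_interior.mem_nhds (hmem x hx t t.2)))
        (by fun_prop)
    filter_upwards [nhdsWithin_le_nhds (hc.eventually (gt_mem_nhds ht)), self_mem_nhdsWithin]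
      with z hz hzK
    exact (hGle z hzK t t.2).trans_lt hz
  · exact hcont.congr hGeq

end IsConcaveHomogeneous

/-! ### Borell's theorem for homogeneous measures -/

section Borell

variable {V : Type*} [NormedAddCommGroup V] [NormedSpace ℝ V] [FiniteDimensional ℝ V]
  [MeasurableSpace V] [BorelSpace V] {lam : Measure V} [lam.IsAddHaarMeasure] {ν : Measure V}

/-- Drop the contribution of y in the superadditivity inequality, take radius 1 at x, and let R
decrease to 1, the radius at y shrinking to 0. -/
theorem lowerDensity_le_add {N : ℕ} (hN : 0 < N) {x y : V}
    (hBM : ∀ a b R : ℝ, 0 < a → 0 < b → a + b < R →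
      ν (Metric.closedBall x a) ^ (N : ℝ)⁻¹ + ν (Metric.closedBall y b) ^ (N : ℝ)⁻¹ ≤
        ν (Metric.closedBall (x + y) R) ^ (N : ℝ)⁻¹) :
    lowerDensity ν lam x ≤ lowerDensity ν lam (x + y) := by
  have hNr : (0 : ℝ) < N := by exact_mod_cast hN
  have h : ∀ R : ℝ, 1 < R →
      lowerDensity ν lam x ≤ ENNReal.ofReal R ^ Module.finrank ℝ V * lowerDensity ν lam (x + y) := by
    intro R hR
    have := lowerDensity_superadditive lam ν hN hBM one_pos (b := (R - 1) / 2) (R := R)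
      (by linarith) (by linarith)
    have := le_self_add.trans this
    rwa [ENNReal.ofReal_one, one_pow, one_mul,
      ENNReal.rpow_le_rpow_iff (inv_pos.2 hNr)] at this
  have hlim : Tendsto (fun R : ℝ => ENNReal.ofReal R ^ Module.finrank ℝ V *
      lowerDensity ν lam (x + y)) (𝓝[>] 1) (𝓝 (lowerDensity ν lam (x + y))) := by
    have h1 : Tendsto (fun R : ℝ => ENNReal.ofReal R ^ Module.finrank ℝ V) (𝓝[>] 1) (𝓝 1) := by
      have : Continuous fun R : ℝ => ENNReal.ofReal R ^ Module.finrank ℝ V :=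
        (ENNReal.continuous_pow _).comp ENNReal.continuous_ofReal
      have := this.tendsto 1
      rw [ENNReal.ofReal_one, one_pow] at this
      exact this.mono_left nhdsWithin_le_nhds
    have := ENNReal.Tendsto.mul_const (b := lowerDensity ν lam (x + y)) h1 (Or.inl one_ne_zero)
    rwa [one_mul] at this
  refine ge_of_tendsto hlim ?_
  filter_upwards [self_mem_nhdsWithin] with R hR using h R hR

variable [IsLocallyFiniteMeasure ν]

/-- An infinite value at x would propagate to all of x + K, a set of positive Lebesgue measure,
whereas the Radon-Nikodym derivative is finite almost everywhere. -/
theorem lowerDensity_ne_top {K : Set V} (hne : (interior K).Nonempty)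
    {N : ℕ} (hN : 0 < N)
    (hBM : ∀ x ∈ K, ∀ y ∈ K, ∀ a b R : ℝ, 0 < a → 0 < b → a + b < R →
      ν (Metric.closedBall x a) ^ (N : ℝ)⁻¹ + ν (Metric.closedBall y b) ^ (N : ℝ)⁻¹ ≤
        ν (Metric.closedBall (x + y) R) ^ (N : ℝ)⁻¹) {x : V} (hx : x ∈ K) :
    lowerDensity ν lam x ≠ ∞ := by
  intro htop
  have hNr : (0 : ℝ) < N := by exact_mod_cast hN
  have hall : ∀ y ∈ K, lowerDensity ν lam (x + y) = ∞ := by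
    intro y hy
    have h := lowerDensity_superadditive lam ν hN (hBM x hx y hy) one_pos one_pos
      (R := 3) (by norm_num)
    rw [htop, ENNReal.ofReal_one, one_pow, one_mul, ENNReal.top_rpow_of_pos (inv_pos.2 hNr),
      top_add, top_le_iff, ENNReal.rpow_eq_top_iff_of_pos (inv_pos.2 hNr)] at h
    by_contra hne
    exact ENNReal.mul_ne_top (ENNReal.pow_ne_top ENNReal.ofReal_ne_top) hne h
  have hopen : IsOpen ((fun z => -x + z) ⁻¹' interior K) :=
    isOpen_interior.preimage (continuous_const.add continuous_id)
  have hpos : lam ((fun z => -x + z) ⁻¹' interior K) ≠ 0 := by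
    obtain ⟨p, hp⟩ := hne
    exact (hopen.measure_pos lam ⟨x + p, by simpa using hp⟩).ne'
  refine hpos (measure_eq_zero_iff_ae_notMem.2 ?_)
  filter_upwards [lowerDensity_ae_eq_rnDeriv (ν := ν) (lam := lam),
    Measure.rnDeriv_lt_top ν lam] with z h1 h2 hz
  have := hall _ (interior_subset hz)
  rw [add_neg_cancel_left, h1] at this
  exact h2.ne this

theorem isConcaveHomogeneous_lowerDensity {K : Set V} (hcone : IsCone K)
    (hne : (interior K).Nonempty) {m : ℕ} (hm : 0 < m)
    (hhom : ∀ c : ℝ, 0 < c → ∀ x r, ν (Metric.closedBall (c • x) (c * r)) =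
      ENNReal.ofReal c ^ (Module.finrank ℝ V + m) * ν (Metric.closedBall x r))
    (hBM : ∀ x ∈ K, ∀ y ∈ K, ∀ a b R : ℝ, 0 < a → 0 < b → a + b < R →
      ν (Metric.closedBall x a) ^ ((Module.finrank ℝ V + m : ℕ) : ℝ)⁻¹ +
        ν (Metric.closedBall y b) ^ ((Module.finrank ℝ V + m : ℕ) : ℝ)⁻¹ ≤
        ν (Metric.closedBall (x + y) R) ^ ((Module.finrank ℝ V + m : ℕ) : ℝ)⁻¹) :
    IsConcaveHomogeneous K fun x => (lowerDensity ν lam x).toReal ^ (m : ℝ)⁻¹ := by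
  set d := Module.finrank ℝ V
  have hN : 0 < d + m := by omega
  have hNr : (0 : ℝ) < (d + m : ℕ) := by exact_mod_cast hN
  have hmr : (0 : ℝ) < m := by exact_mod_cast hm
  have hfin : ∀ x ∈ K, lowerDensity ν lam x ≠ ∞ := fun x hx =>
    lowerDensity_ne_top hne hN hBM hx
  refine ⟨fun x _ => by positivity, fun x hx y hy => ?_, fun x hx c hc => ?_⟩
  · have hxy := hcone.add x hx y hy
    have mono : ∀ x ∈ K, ∀ y ∈ K, (lowerDensity ν lam x).toReal ^ (m : ℝ)⁻¹ ≤
        (lowerDensity ν lam (x + y)).toReal ^ (m : ℝ)⁻¹ := by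
      intro x hx y hy
      have := ENNReal.toReal_mono (hfin _ (hcone.add x hx y hy))
        (lowerDensity_le_add (lam := lam) hN (hBM x hx y hy))
      gcongr
    set a := (lowerDensity ν lam x).toReal ^ (m : ℝ)⁻¹ with ha
    set b := (lowerDensity ν lam y).toReal ^ (m : ℝ)⁻¹ with hb
    have ha0 : 0 ≤ a := by positivity
    have hb0 : 0 ≤ b := by positivity
    -- The values a and b are about to serve as radii and must be positive; a vanishing one is
    -- handled by monotonicity.
    rcases ha0.eq_or_lt with ha' | ha'
    · rw [← ha', zero_add, add_comm x y]
      exact mono y hy x hx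
    rcases hb0.eq_or_lt with hb' | hb'
    · rw [← hb', add_zero]
      exact mono x hx y hy
    have pw : ∀ x ∈ K, lowerDensity ν lam x =
        ENNReal.ofReal ((lowerDensity ν lam x).toReal ^ (m : ℝ)⁻¹) ^ m := by
      intro x hx
      rw [← ENNReal.ofReal_pow (by positivity), Real.rpow_inv_natCast_pow (by positivity) hm.ne',
        ENNReal.ofReal_toReal (hfin x hx)]
    set w := (lowerDensity ν lam (x + y)).toReal ^ (m : ℝ)⁻¹ with hw
    have hw0 : 0 ≤ w := by positivity
    -- With radii a and b, the terms on the left are the (d+m)-th roots of a^d a^m and b^d b^m, that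
    -- is, a and b themselves.
    have h : ∀ R : ℝ, a + b < R → (a + b) ^ (d + m) ≤ R ^ d * w ^ m := by
      intro R hR
      have hR0 : 0 ≤ R := by linarith
      have := lowerDensity_superadditive lam ν hN (hBM x hx y hy) ha' hb' hR
      rw [pw x hx, pw y hy, pw _ hxy, ← pow_add, ← pow_add, ← ENNReal.rpow_natCast,
        ← ENNReal.rpow_natCast (ENNReal.ofReal b), ENNReal.rpow_rpow_inv hNr.ne',
        ENNReal.rpow_rpow_inv hNr.ne', ← ENNReal.ofReal_add ha0 hb0,
        ENNReal.le_rpow_inv_iff hNr, ENNReal.rpow_natCast, ← ENNReal.ofReal_pow (by positivity),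
        ← ENNReal.ofReal_pow (by positivity), ← ENNReal.ofReal_pow (by positivity),
        ← ENNReal.ofReal_mul (by positivity), ENNReal.ofReal_le_ofReal_iff (by positivity)] at this
      exact this
    have hlim : Tendsto (fun R : ℝ => R ^ d * w ^ m) (𝓝[>] (a + b)) (𝓝 ((a + b) ^ d * w ^ m)) := by
      have : Continuous fun R : ℝ => R ^ d * w ^ m := by fun_prop
      exact (this.tendsto _).mono_left nhdsWithin_le_nhds
    have hle : (a + b) ^ (d + m) ≤ (a + b) ^ d * w ^ m := by
      refine ge_of_tendsto hlim ?_
      filter_upwards [self_mem_nhdsWithin] with R hR using h R hR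
    rw [pow_add] at hle
    have := le_of_mul_le_mul_left hle (by positivity)
    exact le_of_pow_le_pow_left₀ hm.ne' hw0 this
  · rw [lowerDensity_smul lam ν hhom hc, ENNReal.toReal_mul, ENNReal.toReal_pow,
      ENNReal.toReal_ofReal hc.le, Real.mul_rpow (by positivity) (by positivity),
      Real.pow_rpow_inv_natCast hc.le hm.ne']

/-- Borell's theorem for homogeneous measures on a closed cone. -/
theorem exists_density_of_brunn_minkowski {K : Set V} (hK : IsClosed K) (hcone : IsCone K)
    (hne : (interior K).Nonempty) (h0 : ν Kᶜ = 0) {m : ℕ} (hN : 0 < Module.finrank ℝ V + m)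
    (hhom : ∀ c : ℝ, 0 < c → ∀ x r, ν (Metric.closedBall (c • x) (c * r)) =
      ENNReal.ofReal c ^ (Module.finrank ℝ V + m) * ν (Metric.closedBall x r))
    (hBM : ∀ x ∈ K, ∀ y ∈ K, ∀ a b R : ℝ, 0 < a → 0 < b → a + b < R →
      ν (Metric.closedBall x a) ^ ((Module.finrank ℝ V + m : ℕ) : ℝ)⁻¹ +
        ν (Metric.closedBall y b) ^ ((Module.finrank ℝ V + m : ℕ) : ℝ)⁻¹ ≤
        ν (Metric.closedBall (x + y) R) ^ ((Module.finrank ℝ V + m : ℕ) : ℝ)⁻¹) :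
    ∃ (c : ℝ) (g : V → ℝ), 0 ≤ c ∧ IsConcaveHomogeneous K g ∧ UpperSemicontinuousOn g K ∧
      ContinuousOn g (interior K) ∧
      ν = lam.withDensity (K.indicator fun x => ENNReal.ofReal (c * g x ^ m)) := by
  have hfin : ∀ x ∈ K, lowerDensity ν lam x ≠ ∞ := fun x hx =>
    lowerDensity_ne_top hne hN hBM hx
  -- The boundary values of the density are irrelevant to ν, since the frontier of a convex set is
  -- Lebesgue-null; off K the lower density vanishes.
  have dens : ∀ φ : V → ℝ, (∀ x ∈ interior K, φ x = (lowerDensity ν lam x).toReal) →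
      ν = lam.withDensity (K.indicator fun x => ENNReal.ofReal (φ x)) := by
    intro φ hφ
    conv_lhs => rw [eq_withDensity_lowerDensity (lam := lam) h0 hfin]
    refine withDensity_congr_ae ?_
    have hfr : ∀ᵐ x ∂lam, x ∉ frontier K :=
      measure_eq_zero_iff_ae_notMem.1 (hcone.convex.addHaar_frontier lam)
    filter_upwards [hfr] with x hx
    by_cases hxK : x ∈ K
    · have hxi : x ∈ interior K := by
        by_contra hxi
        exact hx ⟨subset_closure hxK, hxi⟩
      rw [indicator_of_mem hxK, hφ x hxi, ENNReal.ofReal_toReal (hfin x hxK)]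
    · rw [indicator_of_notMem hxK, lowerDensity_eq_zero hK h0 hxK]
  rcases Nat.eq_zero_or_pos m with rfl | hm
  · obtain ⟨p, hp⟩ := hne
    -- For m = 0 take g = 0: since 0 ^ 0 = 1, the density is the constant c. This is the only case
    -- where c differs from 1.
    refine ⟨(lowerDensity ν lam p).toReal, 0, ENNReal.toReal_nonneg, ⟨?_, ?_, ?_⟩,
      continuousOn_const.upperSemicontinuousOn, continuousOn_const, ?_⟩
    · exact fun x _ => le_rfl
    · intro x _ y _; simp
    · intro x _ c _; simp
    refine dens _ fun x hx => ?_
    have le : ∀ x ∈ interior K, ∀ y ∈ interior K,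
        lowerDensity ν lam x ≤ lowerDensity ν lam y := by
      intro x hx y hy
      -- Write y = εx + (y - εx) with both terms in K; for m = 0 the density is the same at εx and
      -- at x.
      obtain ⟨ε, hε, h⟩ := IsCone.exists_pos_sub_smul_mem hy x
      have := lowerDensity_le_add (lam := lam) hN
        (hBM _ (hcone.smul x (interior_subset hx) ε hε) _ h)
      rwa [add_sub_cancel, lowerDensity_smul lam ν hhom hε, pow_zero, one_mul] at this
    rw [le_antisymm (le x hx p hp) (le p hp x hx)]
    simp
  · obtain ⟨G, h1, h2, h3, h4⟩ := (isConcaveHomogeneous_lowerDensity (lam := lam) hcone hne hm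
      hhom hBM).exists_upperSemicontinuousOn hcone hne
    refine ⟨1, G, zero_le_one, h1, h2, h3, dens _ fun x hx => ?_⟩
    rw [one_mul, h4 x hx, Real.rpow_inv_natCast_pow ENNReal.toReal_nonneg hm.ne']

end Borell

/-! ### Cone measures and polar coordinates -/

section ConeMeasure

variable {F : Type*} [NormedAddCommGroup F] [NormedSpace ℝ F]

/-- Polar coordinates. -/
def polarMap (F : Type*) [NormedAddCommGroup F] [NormedSpace ℝ F]
    (z : Metric.sphere (0 : F) 1 × Ioi (0 : ℝ)) : F := (z.2 : ℝ) • (z.1 : F)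

theorem polarMap_eq_comp :
    polarMap F = Subtype.val ∘ (homeomorphUnitSphereProd F).symm := by
  ext z
  simp [polarMap]

theorem isOpenEmbedding_polarMap : Topology.IsOpenEmbedding (polarMap F) := by
  rw [polarMap_eq_comp]
  exact (isOpen_compl_singleton.isOpenEmbedding_subtypeVal).comp
    (homeomorphUnitSphereProd F).symm.isOpenEmbedding

variable [MeasurableSpace F]

/-- The measure with angular part `μ` and radial part `r ^ p dr`. -/
noncomputable def coneMeasure (p : ℕ) (μ : Measure (Metric.sphere (0 : F) 1)) : Measure F :=
  (μ.prod (Measure.volumeIoiPow p)).map (polarMap F)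

theorem coneMeasure_smul (p : ℕ) (μ : Measure (Metric.sphere (0 : F) 1)) (c : ℝ≥0∞) :
    coneMeasure p (c • μ) = c • coneMeasure p μ := by
  rw [coneMeasure, coneMeasure, Measure.prod_smul_left, Measure.map_smul]

variable [BorelSpace F]

theorem measurableEmbedding_polarMap : MeasurableEmbedding (polarMap F) :=
  isOpenEmbedding_polarMap.measurableEmbedding

theorem lintegral_coneMeasure (p : ℕ) (μ : Measure (Metric.sphere (0 : F) 1)) [SFinite μ]
    {φ : F → ℝ≥0∞} (hφ : Measurable φ) :
    ∫⁻ y, φ y ∂coneMeasure p μ =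
      ∫⁻ x, ∫⁻ r in Ioi (0 : ℝ), ENNReal.ofReal (r ^ p) * φ (r • (x : F)) ∂volume ∂μ := by
  rw [coneMeasure, measurableEmbedding_polarMap.lintegral_map,
    lintegral_prod (fun z => φ (polarMap F z))
      (hφ.comp measurableEmbedding_polarMap.measurable).aemeasurable]
  congr 1; ext x
  have hm : Measurable fun r : ℝ => φ (r • (x : F)) := hφ.comp (by fun_prop)
  rw [Measure.volumeIoiPow, lintegral_withDensity_eq_lintegral_mul _ (by fun_prop)
    (g := fun r => φ (polarMap F (x, r))) (hφ.comp (measurableEmbedding_polarMap.measurable.comp measurable_prodMk_left))]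
  exact lintegral_subtype_comap measurableSet_Ioi
    (fun r : ℝ => ENNReal.ofReal (r ^ p) * φ (r • (x : F)))

theorem coneMeasure_toSphere [FiniteDimensional ℝ F] [Nontrivial F] (lam : Measure F) [lam.IsAddHaarMeasure] :
    coneMeasure (Module.finrank ℝ F - 1) lam.toSphere = lam := by
  have h := lam.measurePreserving_homeomorphUnitSphereProd
  have h' := h.symm (homeomorphUnitSphereProd F).toMeasurableEquiv
  rw [coneMeasure, polarMap_eq_comp, ← Measure.map_map measurable_subtype_coe
    (homeomorphUnitSphereProd F).symm.measurable]
  have e : Measure.map (⇑(homeomorphUnitSphereProd F).symm)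
    (lam.toSphere.prod (Measure.volumeIoiPow (Module.finrank ℝ F - 1))) = lam.comap (↑) := h'.map_eq
  rw [e, map_comap_subtype_coe (measurableSet_singleton _).compl, restrict_compl_singleton]

/-- The cone measure of the truncated cone over A is the measure of A times the positive finite
number 1/(p+1). -/
theorem coneMeasure_injective (p : ℕ) {μ μ' : Measure (Metric.sphere (0 : F) 1)}
    [SFinite μ] [SFinite μ'] (h : coneMeasure p μ = coneMeasure p μ') : μ = μ' := by
  have h := measurableEmbedding_polarMap.map_injective h
  ext A hA
  have h1 := congrArg (fun κ => κ (A ×ˢ Iio (⟨1, mem_Ioi.2 one_pos⟩ : Ioi (0 : ℝ)))) h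
  simp only [Measure.prod_prod, Measure.volumeIoiPow_apply_Iio] at h1
  refine (ENNReal.mul_left_inj ?_ ENNReal.ofReal_ne_top).1 h1
  simp only [ne_eq, ENNReal.ofReal_eq_zero, not_le]
  positivity

theorem coneMeasure_smul_preimage (p : ℕ) (μ : Measure (Metric.sphere (0 : F) 1)) [SFinite μ]
    {c : ℝ} (hc : 0 < c) {A : Set F} (hA : MeasurableSet A) :
    coneMeasure p μ ((fun y => c⁻¹ • y) ⁻¹' A) =
      ENNReal.ofReal c ^ (p + 1) * coneMeasure p μ A := by
  have hA' : MeasurableSet ((fun y : F => c⁻¹ • y) ⁻¹' A) := hA.preimage (by fun_prop)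
  have subst : ∀ G : ℝ → ℝ≥0∞, ∫⁻ r in Ioi (0 : ℝ), G r =
      ∫⁻ s in Ioi (0 : ℝ), ENNReal.ofReal c * G (c * s) := by
    intro G
    have := lintegral_image_eq_lintegral_abs_deriv_mul (s := Ioi (0 : ℝ)) (f := fun s => c * s)
      (f' := fun _ => c) measurableSet_Ioi
      (fun s _ => by simpa using ((hasDerivAt_id s).const_mul c).hasDerivWithinAt)
      (fun s _ t _ hst => mul_left_cancel₀ hc.ne' hst) G
    have himg : (fun s : ℝ => c * s) '' Ioi 0 = Ioi 0 := by
      simp [image_mul_left_Ioi hc]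
    rwa [himg, abs_of_pos hc] at this
  rw [← lintegral_indicator_one hA', ← lintegral_indicator_one hA,
    lintegral_coneMeasure _ _ (measurable_one.indicator hA'),
    lintegral_coneMeasure _ _ (measurable_one.indicator hA), ← lintegral_const_mul']
  · congr 1; ext x
    rw [subst, ← lintegral_const_mul' _ _ (ENNReal.pow_ne_top ENNReal.ofReal_ne_top)]
    refine setLIntegral_congr_fun measurableSet_Ioi fun s hs => ?_
    have hs : 0 < s := hs
    have : ((fun y : F => c⁻¹ • y) ⁻¹' A).indicator (1 : F → ℝ≥0∞) ((c * s) • (x : F)) =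
        A.indicator 1 (s • (x : F)) := by
      have e : c⁻¹ • (c * s) • (x : F) = s • (x : F) := by
        rw [smul_smul, inv_mul_cancel_left₀ hc.ne']
      by_cases hsA : s • (x : F) ∈ A
      · rw [indicator_of_mem hsA, indicator_of_mem (by rwa [mem_preimage, e])]; rfl
      · rw [indicator_of_notMem hsA, indicator_of_notMem (by rwa [mem_preimage, e])]
    simp only [this]
    rw [← mul_assoc, ← mul_assoc, mul_pow, ENNReal.ofReal_mul (by positivity), ← mul_assoc,
      ENNReal.ofReal_pow hc.le, pow_succ']
  · exact ENNReal.pow_ne_top ENNReal.ofReal_ne_top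

theorem coneMeasure_closedBall_smul (p : ℕ) (μ : Measure (Metric.sphere (0 : F) 1)) [SFinite μ]
    {c : ℝ} (hc : 0 < c) (x : F) (r : ℝ) :
    coneMeasure p μ (Metric.closedBall (c • x) (c * r)) =
      ENNReal.ofReal c ^ (p + 1) * coneMeasure p μ (Metric.closedBall x r) := by
  rw [← coneMeasure_smul_preimage p μ hc Metric.isClosed_closedBall.measurableSet]
  congr 1
  ext y
  rw [mem_preimage, Metric.mem_closedBall, Metric.mem_closedBall, dist_eq_norm, dist_eq_norm]
  have : y - c • x = c • (c⁻¹ • y - x) := by rw [smul_sub, smul_inv_smul₀ hc.ne']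
  rw [this, norm_smul, Real.norm_of_nonneg hc.le, mul_le_mul_iff_right₀ hc]

/-- A density homogeneous of degree m splits in polar coordinates into its angular values and a
factor r^m, absorbed by the radial part. -/
theorem coneMeasure_withDensity (p m : ℕ) (μ : Measure (Metric.sphere (0 : F) 1)) [SFinite μ]
    {h : F → ℝ≥0∞} (hh : Measurable h)
    (hom : ∀ r : ℝ, 0 < r → ∀ x, h (r • x) = ENNReal.ofReal r ^ m * h x) :
    (coneMeasure p μ).withDensity h = coneMeasure (p + m) (μ.withDensity fun x => h x) := by
  ext A hA
  have hx : Measurable fun x : Metric.sphere (0 : F) 1 => h x := hh.comp measurable_subtype_coe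
  have hmeas : Measurable fun x : Metric.sphere (0 : F) 1 =>
      ∫⁻ r in Ioi (0 : ℝ), ENNReal.ofReal (r ^ (p + m)) * A.indicator 1 (r • (x : F)) := by
    refine Measurable.lintegral_prod_right' (f := fun z : Metric.sphere (0 : F) 1 × ℝ =>
      ENNReal.ofReal (z.2 ^ (p + m)) * A.indicator 1 (z.2 • (z.1 : F))) ?_
    have : Measurable (A.indicator (1 : F → ℝ≥0∞)) := measurable_one.indicator hA
    exact Measurable.mul (by fun_prop) (this.comp (by fun_prop))
  rw [withDensity_apply _ hA, ← lintegral_indicator hA, ← lintegral_indicator_one hA,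
    lintegral_coneMeasure _ _ (hh.indicator hA),
    lintegral_coneMeasure _ _ (measurable_one.indicator hA),
    lintegral_withDensity_eq_lintegral_mul _ hx hmeas]
  congr 1; ext x
  have hmeas' : Measurable fun r : ℝ =>
      ENNReal.ofReal (r ^ (p + m)) * A.indicator (1 : F → ℝ≥0∞) (r • (x : F)) := by
    have : Measurable (A.indicator (1 : F → ℝ≥0∞)) := measurable_one.indicator hA
    exact Measurable.mul (by fun_prop) (this.comp (by fun_prop))
  rw [Pi.mul_apply, ← lintegral_const_mul _ hmeas']
  refine setLIntegral_congr_fun measurableSet_Ioi fun r hr => ?_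
  have hr : 0 < r := hr
  by_cases hrA : r • (x : F) ∈ A
  · simp only [indicator_of_mem hrA, Pi.one_apply, mul_one]
    rw [hom r hr, pow_add, ENNReal.ofReal_mul (by positivity), ENNReal.ofReal_pow hr.le m]
    ring
  · simp [indicator_of_notMem hrA]

theorem coneMeasure_restrict (p : ℕ) (μ : Measure (Metric.sphere (0 : F) 1)) [SFinite μ]
    (S : Set (Metric.sphere (0 : F) 1)) :
    coneMeasure p (μ.restrict S) = (coneMeasure p μ).restrict (polarMap F '' (S ×ˢ univ)) := by
  rw [coneMeasure, coneMeasure, measurableEmbedding_polarMap.restrict_map,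
    preimage_image_eq _ measurableEmbedding_polarMap.injective,
    ← Measure.prod_restrict, Measure.restrict_univ]

theorem coneMeasure_map {F' : Type*} [NormedAddCommGroup F'] [NormedSpace ℝ F']
    [MeasurableSpace F'] [BorelSpace F'] (p : ℕ)
    (μ : Measure (Metric.sphere (0 : F) 1)) [SFinite μ] (L : F →L[ℝ] F')
    {i : Metric.sphere (0 : F) 1 → Metric.sphere (0 : F') 1} (hi : Measurable i)
    (hL : ∀ x : Metric.sphere (0 : F) 1, L x = i x) :
    coneMeasure p (μ.map i) = (coneMeasure p μ).map L := by
  have hid : Measure.volumeIoiPow p = (Measure.volumeIoiPow p).map id := Measure.map_id.symm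
  rw [coneMeasure, coneMeasure, Measure.map_map L.continuous.measurable
    measurableEmbedding_polarMap.measurable]
  conv_lhs => rw [hid]
  rw [Measure.map_prod_map _ _ hi measurable_id, Measure.map_map
    measurableEmbedding_polarMap.measurable (hi.prodMap measurable_id)]
  congr 1
  ext z
  simp [polarMap, hL]

/-- Otherwise the explicit measures of the intervals below t and below some u > t would agree. -/
theorem volumeIoiPow_pos_of_mem_nhds (p : ℕ) {t : Ioi (0 : ℝ)} {W : Set (Ioi (0 : ℝ))}
    (hW : W ∈ 𝓝 t) : 0 < Measure.volumeIoiPow p W := by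
  obtain ⟨l, u, ⟨hl, hu⟩, hlu⟩ := mem_nhds_iff_exists_Ioo_subset.1 hW
  by_contra h0
  have h0 : Measure.volumeIoiPow p W = 0 := by simpa using h0
  have hsub : Iio u ⊆ Iio t ∪ W := fun s hs => by
    rcases lt_or_ge s t with h | h
    · exact Or.inl h
    · exact Or.inr (hlu ⟨hl.trans_le h, hs⟩)
  have := (measure_mono (μ := Measure.volumeIoiPow p) hsub).trans (measure_union_le _ _)
  rw [h0, add_zero, Measure.volumeIoiPow_apply_Iio, Measure.volumeIoiPow_apply_Iio,
    ENNReal.ofReal_le_ofReal_iff (by have := t.2.out; positivity)] at this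
  have hlt : (t : ℝ) ^ (p + 1) < (u : ℝ) ^ (p + 1) :=
    pow_lt_pow_left₀ (Subtype.coe_lt_coe.2 hu) (le_of_lt t.2.out) (by omega)
  have : (u : ℝ) ^ (p + 1) ≤ (t : ℝ) ^ (p + 1) := by
    have hp : (0 : ℝ) < p + 1 := by positivity
    exact (div_le_div_iff_of_pos_right hp).1 this
  linarith

theorem coneMeasure_pos_of_mem_support (p : ℕ) {μ : Measure (Metric.sphere (0 : F) 1)}
    [SFinite μ] {s : Metric.sphere (0 : F) 1} (hs : s ∈ μ.support) {t : ℝ} (ht : 0 < t) {U : Set F}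
    (hU : IsOpen U) (hx : t • (s : F) ∈ U) : 0 < coneMeasure p μ U := by
  have hU' : polarMap F ⁻¹' U ∈ 𝓝 (s, (⟨t, ht⟩ : Ioi (0 : ℝ))) :=
    (hU.preimage isOpenEmbedding_polarMap.continuous).mem_nhds hx
  rw [nhds_prod_eq, mem_prod_iff] at hU'
  obtain ⟨A, hA, W, hW, hAW⟩ := hU'
  rw [coneMeasure, measurableEmbedding_polarMap.map_apply]
  refine lt_of_lt_of_le ?_ (measure_mono hAW)
  rw [Measure.prod_prod]
  exact ENNReal.mul_pos ((Measure.mem_support_iff_forall s).1 hs A hA).ne'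
    (volumeIoiPow_pos_of_mem_nhds p hW).ne'

/-- The angular average of a test function along rays. -/
theorem lintegral_coneMeasure_eq_integral (p : ℕ) [ProperSpace F] {φ : F → ℝ} (hφ : Continuous φ)
    (hc : HasCompactSupport φ) (h0 : ∀ y, 0 ≤ φ y) :
    ∃ Φ : Metric.sphere (0 : F) 1 → ℝ, Continuous Φ ∧
      ∀ μ : Measure (Metric.sphere (0 : F) 1), IsFiniteMeasure μ →
        ∫⁻ y, ENNReal.ofReal (φ y) ∂coneMeasure p μ = ENNReal.ofReal (∫ x, Φ x ∂μ) := by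
  obtain ⟨R, hR⟩ := hc.isCompact.isBounded.subset_closedBall (0 : F)
  set R' := max R 0
  have hR' : 0 ≤ R' := le_max_right _ _
  -- The radial integral thus runs over a fixed compact interval, which makes it continuous in the
  -- direction x.
  have hzero : ∀ (x : Metric.sphere (0 : F) 1) (r : ℝ), R' < r → φ (r • (x : F)) = 0 := by
    intro x r hr
    by_contra hne
    have hmem := hR (subset_tsupport _ hne)
    rw [mem_closedBall_zero_iff, norm_smul, norm_eq_of_mem_sphere, mul_one,
      Real.norm_of_nonneg (hR'.trans hr.le)] at hmem
    exact absurd ((le_max_left R 0).trans_lt hr) (not_lt.2 hmem)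
  have hcont2 : Continuous fun z : Metric.sphere (0 : F) 1 × ℝ => z.2 ^ p * φ (z.2 • (z.1 : F)) := by
    fun_prop
  have hΦ : Continuous fun x : Metric.sphere (0 : F) 1 => ∫ r in (0 : ℝ)..R', r ^ p * φ (r • (x : F)) :=
    intervalIntegral.continuous_parametric_intervalIntegral_of_continuous' hcont2 0 R'
  have hΦ0 : ∀ x : Metric.sphere (0 : F) 1, 0 ≤ ∫ r in (0 : ℝ)..R', r ^ p * φ (r • (x : F)) :=
    fun x => intervalIntegral.integral_nonneg hR' fun r hr =>
      mul_nonneg (pow_nonneg hr.1 p) (h0 _)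
  refine ⟨_, hΦ, fun μ _ => ?_⟩
  have hint : Integrable (fun x : Metric.sphere (0 : F) 1 =>
      ∫ r in (0 : ℝ)..R', r ^ p * φ (r • (x : F))) μ :=
    (BoundedContinuousFunction.mkOfCompact ⟨_, hΦ⟩).integrable μ
  rw [lintegral_coneMeasure _ _ (by fun_prop), ofReal_integral_eq_lintegral_ofReal hint
    (ae_of_all _ hΦ0)]
  congr 1; ext x
  have hcx : Continuous fun r : ℝ => r ^ p * φ (r • (x : F)) := by fun_prop
  rw [intervalIntegral.integral_of_le hR', ofReal_integral_eq_lintegral_ofReal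
    ((hcx.intervalIntegrable 0 R').1), ← Ioc_union_Ioi_eq_Ioi hR',
    lintegral_union measurableSet_Ioi (Ioc_disjoint_Ioi le_rfl)]
  · have e1 : ∫⁻ r in Ioi R', ENNReal.ofReal (r ^ p) * ENNReal.ofReal (φ (r • (x : F))) = 0 := by
      rw [setLIntegral_congr_fun measurableSet_Ioi (g := fun _ => 0)
        (fun r hr => by simp [hzero x r hr])]
      simp
    rw [e1, add_zero]
    refine setLIntegral_congr_fun measurableSet_Ioc fun r hr => ?_
    exact (ENNReal.ofReal_mul (pow_nonneg hr.1.le p)).symm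
  · filter_upwards [ae_restrict_mem measurableSet_Ioc] with r hr
    exact mul_nonneg (pow_nonneg hr.1.le p) (h0 _)

end ConeMeasure

/-! ### Brunn-Minkowski under vague limits -/

theorem exists_bump_closedBall {F : Type*} [NormedAddCommGroup F] [ProperSpace F] (x : F)
    (a : ℝ) {δ : ℝ} (hδ : 0 < δ) :
    ∃ φ : F → ℝ, Continuous φ ∧ HasCompactSupport φ ∧ (∀ y, 0 ≤ φ y) ∧
      (∀ y, (Metric.closedBall x a).indicator (1 : F → ℝ≥0∞) y ≤ ENNReal.ofReal (φ y)) ∧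
      ∀ y, ENNReal.ofReal (φ y) ≤ (Metric.closedBall x (a + δ)).indicator (1 : F → ℝ≥0∞) y := by
  set φ : F → ℝ := fun y => max 0 (min 1 ((a + δ - dist y x) / δ)) with hφ
  have hz : ∀ y ∉ Metric.closedBall x (a + δ), φ y = 0 := by
    intro y hy
    rw [Metric.mem_closedBall, not_le] at hy
    refine max_eq_left ((min_le_right _ _).trans ?_)
    exact div_nonpos_of_nonpos_of_nonneg (by linarith) hδ.le
  refine ⟨φ, by fun_prop, HasCompactSupport.intro (isCompact_closedBall x (a + δ)) hz,
    fun y => le_max_left _ _, fun y => ?_, fun y => ?_⟩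
  · by_cases hy : y ∈ Metric.closedBall x a
    · rw [indicator_of_mem hy, Pi.one_apply, ENNReal.one_le_ofReal]
      refine le_max_of_le_right (le_min le_rfl ?_)
      rw [one_le_div hδ]
      linarith [Metric.mem_closedBall.1 hy]
    · rw [indicator_of_notMem hy]; exact zero_le
  · by_cases hy : y ∈ Metric.closedBall x (a + δ)
    · rw [indicator_of_mem hy, Pi.one_apply, ENNReal.ofReal_le_one]
      exact max_le zero_le_one (min_le_left _ _)
    · rw [indicator_of_notMem hy, hz y hy, ENNReal.ofReal_zero]

/-- Continuous bumps stand between indicators of balls and of slightly larger ones; the strict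
inequality a + b < R pays for the enlargement. Positivity matters because Brunn-Minkowski fails when
one set is empty. -/
theorem brunn_minkowski_of_tendsto {N : ℕ} (hN : 0 < N)
    {ν : Measure (EuclideanSpace ℝ (Fin N))} {c : ℕ → ℝ≥0∞}
    {C : ℕ → Set (EuclideanSpace ℝ (Fin N))} (hC : ∀ i, MeasurableSet (C i))
    (hadd : ∀ i, ∀ x ∈ C i, ∀ y ∈ C i, x + y ∈ C i)
    (hlim : ∀ φ : EuclideanSpace ℝ (Fin N) → ℝ, Continuous φ → HasCompactSupport φ →
      (∀ y, 0 ≤ φ y) → Tendsto (fun i => ∫⁻ y, ENNReal.ofReal (φ y) ∂(c i • volume.restrict (C i)))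
        atTop (𝓝 (∫⁻ y, ENNReal.ofReal (φ y) ∂ν)))
    {x y : EuclideanSpace ℝ (Fin N)} {a b R : ℝ} (hR : a + b < R)
    (hx : 0 < ν (Metric.closedBall x a)) (hy : 0 < ν (Metric.closedBall y b)) :
    ν (Metric.closedBall x a) ^ (N : ℝ)⁻¹ + ν (Metric.closedBall y b) ^ (N : ℝ)⁻¹ ≤
      ν (Metric.closedBall (x + y) R) ^ (N : ℝ)⁻¹ := by
  have hi : (0 : ℝ) ≤ (N : ℝ)⁻¹ := by positivity
  set κ : ℕ → Measure (EuclideanSpace ℝ (Fin N)) := fun i => c i • volume.restrict (C i)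
  -- A third of the slack for each of the three bumps.
  obtain ⟨δ, hδ, hδR⟩ : ∃ δ : ℝ, 0 < δ ∧ a + δ + (b + δ) + δ = R :=
    ⟨(R - a - b) / 3, by linarith, by ring⟩
  have hball : ∀ (z : EuclideanSpace ℝ (Fin N)) (r : ℝ), MeasurableSet (Metric.closedBall z r) :=
    fun z r => Metric.isClosed_closedBall.measurableSet
  have bump : ∀ (z : EuclideanSpace ℝ (Fin N)) (r : ℝ), ∃ (I : ℕ → ℝ≥0∞) (J : ℝ≥0∞),
      Tendsto I atTop (𝓝 J) ∧ ν (Metric.closedBall z r) ≤ J ∧ J ≤ ν (Metric.closedBall z (r + δ)) ∧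
      ∀ i, κ i (Metric.closedBall z r) ≤ I i ∧ I i ≤ κ i (Metric.closedBall z (r + δ)) := by
    intro z r
    obtain ⟨φ, h1, h2, h3, h4, h5⟩ := exists_bump_closedBall z r hδ
    have lo : ∀ κ : Measure (EuclideanSpace ℝ (Fin N)),
        κ (Metric.closedBall z r) ≤ ∫⁻ y, ENNReal.ofReal (φ y) ∂κ := fun κ => by
      rw [← lintegral_indicator_one (hball z r)]; exact lintegral_mono h4
    have hi : ∀ κ : Measure (EuclideanSpace ℝ (Fin N)),
        ∫⁻ y, ENNReal.ofReal (φ y) ∂κ ≤ κ (Metric.closedBall z (r + δ)) := fun κ => by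
      rw [← lintegral_indicator_one (hball z (r + δ))]; exact lintegral_mono h5
    exact ⟨_, _, hlim φ h1 h2 h3, lo ν, hi ν, fun i => ⟨lo _, hi _⟩⟩
  obtain ⟨I₁, J₁, t₁, l₁, -, m₁⟩ := bump x a
  obtain ⟨I₂, J₂, t₂, l₂, -, m₂⟩ := bump y b
  obtain ⟨I₃, J₃, t₃, -, u₃, m₃⟩ := bump (x + y) (a + δ + (b + δ))
  rw [hδR] at u₃
  have cont := fun {I : ℕ → ℝ≥0∞} {J : ℝ≥0∞} (t : Tendsto I atTop (𝓝 J)) =>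
    ((ENNReal.continuous_rpow_const (y := (N : ℝ)⁻¹)).tendsto J).comp t
  -- For large i both enlarged balls meet the cone in positive volume, so Brunn-Minkowski applies to
  -- the intersections, whose sums stay in the cone.
  have key : ∀ᶠ i in atTop, I₁ i ^ (N : ℝ)⁻¹ + I₂ i ^ (N : ℝ)⁻¹ ≤ I₃ i ^ (N : ℝ)⁻¹ := by
    filter_upwards [t₁.eventually (lt_mem_nhds (hx.trans_le l₁)),
      t₂.eventually (lt_mem_nhds (hy.trans_le l₂))] with i h1 h2
    have val : ∀ z r, κ i (Metric.closedBall z r) = c i * volume (Metric.closedBall z r ∩ C i) := by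
      intro z r
      simp only [κ, Measure.smul_apply, smul_eq_mul, Measure.restrict_apply (hball z r)]
    have p1 := (h1.trans_le (m₁ i).2).ne'
    have p2 := (h2.trans_le (m₂ i).2).ne'
    rw [val] at p1 p2
    have fin : ∀ z r, volume (Metric.closedBall z r ∩ C i) ≠ ∞ := fun z r =>
      ((measure_mono inter_subset_left).trans_lt measure_closedBall_lt_top).ne
    have bm := brunn_minkowski hN ((hball x (a + δ)).inter (hC i)) ((hball y (b + δ)).inter (hC i))
      ((hball (x + y) (a + δ + (b + δ))).inter (hC i)) (right_ne_zero_of_mul p1)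
      (right_ne_zero_of_mul p2) (fin _ _) (fin _ _) (by
        rintro u ⟨hu, huC⟩ v ⟨hv, hvC⟩
        refine ⟨?_, hadd i u huC v hvC⟩
        rw [Metric.mem_closedBall] at *
        exact (dist_add_add_le u v x y).trans (add_le_add hu hv))
    calc I₁ i ^ (N : ℝ)⁻¹ + I₂ i ^ (N : ℝ)⁻¹
        ≤ κ i (Metric.closedBall x (a + δ)) ^ (N : ℝ)⁻¹ +
          κ i (Metric.closedBall y (b + δ)) ^ (N : ℝ)⁻¹ :=
          add_le_add (ENNReal.rpow_le_rpow (m₁ i).2 hi) (ENNReal.rpow_le_rpow (m₂ i).2 hi)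
      _ ≤ κ i (Metric.closedBall (x + y) (a + δ + (b + δ))) ^ (N : ℝ)⁻¹ := by
          rw [val, val, val, ENNReal.mul_rpow_of_nonneg _ _ hi, ENNReal.mul_rpow_of_nonneg _ _ hi,
            ENNReal.mul_rpow_of_nonneg _ _ hi, ← mul_add]
          gcongr
      _ ≤ _ := ENNReal.rpow_le_rpow (m₃ i).1 hi
  refine (add_le_add (ENNReal.rpow_le_rpow l₁ hi) (ENNReal.rpow_le_rpow l₂ hi)).trans
    (le_trans ?_ (ENNReal.rpow_le_rpow u₃ hi))
  exact le_of_tendsto_of_tendsto ((cont t₁).add (cont t₂)) (cont t₃) key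

/-! ### Cone measures of convexely derived measures -/

section Sphere

variable {n : ℕ}

theorem isProbabilityMeasure_cond_sphVol {S : Set (Sph n)} (hS : IsOpen S) (hne : S.Nonempty) :
    IsProbabilityMeasure (ProbabilityTheory.cond (sphVol n) S) := by
  have : IsFiniteMeasure (sphVol n) := by unfold sphVol; infer_instance
  have : (sphVol n).IsOpenPosMeasure := by unfold sphVol; infer_instance
  exact ProbabilityTheory.cond_isProbabilityMeasure (hS.measure_pos _ hne).ne'

/-- The sphere is compact, so the constant 1 is a test function and no mass is lost. -/
theorem IsConvexelyDerived.isProbabilityMeasure {μ : Measure (Sph n)} (hμ : IsConvexelyDerived μ) :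
    IsProbabilityMeasure μ := by
  obtain ⟨hfin, S, hS, hlim⟩ := hμ
  have : IsFiniteMeasure μ := ⟨isCompact_univ.measure_lt_top⟩
  have h := hlim (fun _ => 1) continuous_const (HasCompactSupport.of_compactSpace _)
  have h1 : ∀ i, ∫ _, (1 : ℝ) ∂(ProbabilityTheory.cond (sphVol n) (S i)) = 1 := fun i => by
    have := isProbabilityMeasure_cond_sphVol (hS i).1 (hS i).2.1
    simp
  simp only [h1] at h
  have := tendsto_nhds_unique h tendsto_const_nhds
  simp only [integral_const, smul_eq_mul, mul_one] at this
  refine ⟨?_⟩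
  rw [measureReal_def] at this
  rw [← ENNReal.ofReal_toReal (measure_ne_top μ univ), this, ENNReal.ofReal_one]

theorem mem_image_polarMap_iff {S : Set (Sph n)} {y : EuclideanSpace ℝ (Fin (n + 1))} :
    y ∈ polarMap _ '' (S ×ˢ univ) ↔ ∃ t : ℝ, 0 < t ∧ ∃ x ∈ S, y = t • (x : EuclideanSpace ℝ _) := by
  constructor
  · rintro ⟨⟨x, t⟩, ⟨hx, -⟩, rfl⟩
    exact ⟨t, t.2, x, hx, rfl⟩
  · rintro ⟨t, ht, x, hx, rfl⟩
    exact ⟨(x, ⟨t, ht⟩), ⟨hx, mem_univ _⟩, rfl⟩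

theorem coneOver_smul {S : Set (Sph n)} {y : EuclideanSpace ℝ (Fin (n + 1))} (hy : y ∈ coneOver S)
    {c : ℝ} (hc : 0 ≤ c) : c • y ∈ coneOver S := by
  obtain ⟨t, ht, x, hx, rfl⟩ := hy
  exact ⟨c * t, by positivity, x, hx, smul_smul _ _ _⟩

theorem SphConvex.isCone_coneOver {S : Set (Sph n)} (hS : SphConvex S) : IsCone (coneOver S) := by
  refine ⟨fun x hx y hy => ?_, fun x hx c hc => coneOver_smul hx hc.le⟩
  have := hS.2 (coneOver_smul hx zero_le_two) (coneOver_smul hy zero_le_two)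
    (show (0 : ℝ) ≤ 1 / 2 by norm_num) (show (0 : ℝ) ≤ 1 / 2 by norm_num) (by norm_num)
  simpa [smul_smul] using this

theorem coneOver_eq_insert {S : Set (Sph n)} (hne : S.Nonempty) :
    coneOver S = insert 0 (polarMap _ '' (S ×ˢ univ)) := by
  ext y
  rw [mem_insert_iff, mem_image_polarMap_iff]
  constructor
  · rintro ⟨t, ht, x, hx, rfl⟩
    rcases ht.eq_or_lt with rfl | ht
    · exact Or.inl (zero_smul _ _)
    · exact Or.inr ⟨t, ht, x, hx, rfl⟩
  · rintro (rfl | ⟨t, ht, x, hx, rfl⟩)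
    · obtain ⟨x, hx⟩ := hne
      exact ⟨0, le_rfl, x, hx, (zero_smul _ _).symm⟩
    · exact ⟨t, ht.le, x, hx, rfl⟩

theorem coneMeasure_cond_sphVol {S : Set (Sph n)} (ho : IsOpen S) (hne : S.Nonempty) :
    MeasurableSet (coneOver S) ∧ coneMeasure n (ProbabilityTheory.cond (sphVol n) S) =
      (sphVol n S)⁻¹ • (volume.restrict (coneOver S)) := by
  have hopen : IsOpen (polarMap (EuclideanSpace ℝ (Fin (n + 1))) '' (S ×ˢ univ)) :=
    isOpenEmbedding_polarMap.isOpenMap _ (ho.prod isOpen_univ)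
  have : IsFiniteMeasure (sphVol n) := by unfold sphVol; infer_instance
  have hvol : coneMeasure n (sphVol n) = volume := by
    have := coneMeasure_toSphere (volume : Measure (EuclideanSpace ℝ (Fin (n + 1))))
    rwa [finrank_euclideanSpace_fin, Nat.add_sub_cancel] at this
  rw [coneOver_eq_insert hne]
  refine ⟨hopen.measurableSet.insert 0, ?_⟩
  rw [ProbabilityTheory.cond, coneMeasure_smul, coneMeasure_restrict, hvol,
    Measure.restrict_congr_set (insert_ae_eq_self _ _)]

theorem IsConvexelyDerived.brunn_minkowski {μ : Measure (Sph n)} (hμ : IsConvexelyDerived μ)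
    {x y : EuclideanSpace ℝ (Fin (n + 1))} {a b R : ℝ} (hR : a + b < R)
    (hx : 0 < coneMeasure n μ (Metric.closedBall x a))
    (hy : 0 < coneMeasure n μ (Metric.closedBall y b)) :
    coneMeasure n μ (Metric.closedBall x a) ^ ((n + 1 : ℕ) : ℝ)⁻¹ +
      coneMeasure n μ (Metric.closedBall y b) ^ ((n + 1 : ℕ) : ℝ)⁻¹ ≤
      coneMeasure n μ (Metric.closedBall (x + y) R) ^ ((n + 1 : ℕ) : ℝ)⁻¹ := by
  have := hμ.isProbabilityMeasure
  obtain ⟨-, S, hS, hlim⟩ := hμ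
  refine brunn_minkowski_of_tendsto n.succ_pos (c := fun i => (sphVol n (S i))⁻¹)
    (C := fun i => coneOver (S i))
    (fun i => (coneMeasure_cond_sphVol (hS i).1 (hS i).2.1).1)
    (fun i => (hS i).2.2.isCone_coneOver.add) (fun φ h1 h2 h3 => ?_) hR hx hy
  -- Integrating along rays turns a test function on the vector space into one on the sphere, where
  -- convergence is known.
  obtain ⟨Φ, hΦ, h⟩ := lintegral_coneMeasure_eq_integral n h1 h2 h3
  rw [h μ inferInstance]
  refine (ENNReal.tendsto_ofReal (hlim Φ hΦ (HasCompactSupport.of_compactSpace _))).congr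
    fun i => ?_
  have := isProbabilityMeasure_cond_sphVol (hS i).1 (hS i).2.1
  rw [← h _ inferInstance, (coneMeasure_cond_sphVol (hS i).1 (hS i).2.1).2]

end Sphere

theorem isLocallyFiniteMeasure_coneMeasure {F : Type*} [NormedAddCommGroup F] [NormedSpace ℝ F]
    [MeasurableSpace F] [BorelSpace F] [ProperSpace F] (p : ℕ)
    (μ : Measure (Metric.sphere (0 : F) 1)) [IsFiniteMeasure μ] :
    IsLocallyFiniteMeasure (coneMeasure p μ) := by
  refine ⟨fun x => ⟨Metric.closedBall x 1, Metric.closedBall_mem_nhds x one_pos, ?_⟩⟩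
  obtain ⟨φ, h1, h2, h3, h4, -⟩ := exists_bump_closedBall x 1 one_pos
  obtain ⟨Φ, -, h⟩ := lintegral_coneMeasure_eq_integral p h1 h2 h3
  rw [← lintegral_indicator_one Metric.isClosed_closedBall.measurableSet]
  exact (lintegral_mono h4).trans_lt ((h μ inferInstance).trans_lt ENNReal.ofReal_lt_top)

/-! ### Concave homogeneous functions along arcs -/

namespace IsConcaveHomogeneous

variable {V : Type*} [NormedAddCommGroup V] [NormedSpace ℝ V] {K : Set V} {g : V → ℝ}

/-- A lower bound along an arc of an ellipse, seen from one of its points. -/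
theorem le_of_arc (hK : IsCone K) (hg : IsConcaveHomogeneous K g) {p q : V} {s t r : ℝ}
    (hs : Real.cos s • p + Real.sin s • q ∈ K) (ht : Real.cos t • p + Real.sin t • q ∈ K)
    (h1 : 0 < Real.sin (t - r) / Real.sin (t - s)) (h2 : 0 < Real.sin (r - s) / Real.sin (t - s)) :
    Real.sin (t - r) / Real.sin (t - s) * g (Real.cos s • p + Real.sin s • q) ≤
      g (Real.cos r • p + Real.sin r • q) := by
  have hne : Real.sin (t - s) ≠ 0 := fun h => by simp [h] at h1
  -- For w(r) = cos r p + sin r q, this is the identity sin(t-s) w(r) = sin(t-r) w(s) + sin(r-s)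
  -- w(t).
  have e : Real.cos r • p + Real.sin r • q =
      (Real.sin (t - r) / Real.sin (t - s)) • (Real.cos s • p + Real.sin s • q) +
      (Real.sin (r - s) / Real.sin (t - s)) • (Real.cos t • p + Real.sin t • q) := by
    have hc : Real.cos r = Real.sin (t - r) / Real.sin (t - s) * Real.cos s +
        Real.sin (r - s) / Real.sin (t - s) * Real.cos t := by
      field_simp
      simp only [Real.sin_sub]; ring
    have hsn : Real.sin r = Real.sin (t - r) / Real.sin (t - s) * Real.sin s +
        Real.sin (r - s) / Real.sin (t - s) * Real.sin t := by
      field_simp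
      simp only [Real.sin_sub]; ring
    rw [hc, hsn]
    module
  rw [e, ← hg.smul _ hs _ h1]
  have h3 := hK.smul _ ht _ h2
  have := hg.add_le _ (hK.smul _ hs _ h1) _ h3
  linarith [hg.nonneg _ h3]

/-- Only lower semicontinuity needs an argument: seen from s, the factor in `le_of_arc` tends to 1
as r tends to s. Each side of s uses its own auxiliary point t, and no interior point of K is
needed. -/
theorem continuousOn_arc (hK : IsCone K) (hg : IsConcaveHomogeneous K g)
    (husc : UpperSemicontinuousOn g K) {p q : V} {a b : ℝ}
    (hmem : ∀ t ∈ Icc a b, Real.cos t • p + Real.sin t • q ∈ K) :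
    ContinuousOn (fun t => g (Real.cos t • p + Real.sin t • q)) (Icc a b) := by
  set w : ℝ → V := fun t => Real.cos t • p + Real.sin t • q
  have hw : Continuous w := by fun_prop
  have hratio : ∀ {s t : ℝ}, Real.sin (t - s) ≠ 0 → ∀ {y : ℝ}, y < g (w s) →
      ∀ᶠ r in 𝓝 s, 0 < Real.sin (t - r) / Real.sin (t - s) ∧
        y < Real.sin (t - r) / Real.sin (t - s) * g (w s) := by
    intro s t hne y hy
    have hc : Continuous fun r => Real.sin (t - r) / Real.sin (t - s) := by fun_prop
    have h1 := hc.tendsto s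
    have h2 := (hc.mul_const (g (w s))).tendsto s
    simp only [div_self hne, one_mul] at h1 h2
    exact (h1.eventually (lt_mem_nhds one_pos)).and (h2.eventually (lt_mem_nhds hy))
  intro s hs
  refine continuousWithinAt_iff_lower_upperSemicontinuousWithinAt.2 ⟨?_, ?_⟩
  · intro y hy
    have right : ∀ᶠ r in 𝓝 s, r ∈ Icc a b → s < r → y < g (w r) := by
      rcases lt_or_ge s b with hsb | hsb
      -- Staying within distance 1 < π of s fixes the signs of the sines.
      · set t := min b (s + 1) with ht
        have hst : s < t := lt_min hsb (by linarith)
        have hts : t ≤ s + 1 := min_le_right _ _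
        have htI : t ∈ Icc a b := ⟨hs.1.trans hst.le, min_le_left _ _⟩
        have hpi := Real.pi_gt_three
        have hpos : 0 < Real.sin (t - s) :=
          Real.sin_pos_of_pos_of_lt_pi (by linarith) (by linarith)
        filter_upwards [hratio hpos.ne' hy, gt_mem_nhds hst] with r hr hrt _ hsr
        exact hr.2.trans_le (hg.le_of_arc hK (hmem s hs) (hmem t htI) hr.1
          (div_pos (Real.sin_pos_of_pos_of_lt_pi (by linarith) (by linarith)) hpos))
      · exact Eventually.of_forall fun r hr hsr => absurd hr.2 (not_le.2 (hsb.trans_lt hsr))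
    have left : ∀ᶠ r in 𝓝 s, r ∈ Icc a b → r < s → y < g (w r) := by
      rcases lt_or_ge a s with hsb | hsb
      · set t := max a (s - 1) with ht
        have hst : t < s := max_lt hsb (by linarith)
        have hts : s - 1 ≤ t := le_max_right _ _
        have htI : t ∈ Icc a b := ⟨le_max_left _ _, hst.le.trans hs.2⟩
        have hpi := Real.pi_gt_three
        have hneg : Real.sin (t - s) < 0 :=
          Real.sin_neg_of_neg_of_neg_pi_lt (by linarith) (by linarith)
        filter_upwards [hratio hneg.ne hy, lt_mem_nhds hst] with r hr hrt _ hsr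
        exact hr.2.trans_le (hg.le_of_arc hK (hmem s hs) (hmem t htI) hr.1
          (div_pos_of_neg_of_neg
            (Real.sin_neg_of_neg_of_neg_pi_lt (by linarith) (by linarith)) hneg))
      · exact Eventually.of_forall fun r hr hsr => absurd hr.1 (not_le.2 (hsr.trans_le hsb))
    filter_upwards [nhdsWithin_le_nhds right, nhdsWithin_le_nhds left, self_mem_nhdsWithin]
      with r h1 h2 hr
    rcases lt_trichotomy s r with h | rfl | h
    · exact h1 hr h
    · exact hy
    · exact h2 hr h
  · intro y hy
    have : Tendsto w (𝓝[Icc a b] s) (𝓝[K] (w s)) :=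
      tendsto_nhdsWithin_iff.2 ⟨hw.continuousAt.tendsto.mono_left nhdsWithin_le_nhds,
        eventually_mem_nhdsWithin.mono fun t ht => hmem t ht⟩
    exact this.eventually (husc _ (hmem s hs) y hy)

/-- Pull g and K back by the linear map from the plane sending the standard basis to p and q. -/
theorem sinConcaveOn (hK : IsCone K) (hg : IsConcaveHomogeneous K g) {p q : V} {c : ℝ} (hc : 0 ≤ c)
    {I : Set ℝ} (hmem : ∀ t ∈ I, Real.cos t • p + Real.sin t • q ∈ K) :
    SinConcaveOn I fun t => c * g (Real.cos t • p + Real.sin t • q) := by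
  set L : EuclideanSpace ℝ (Fin 2) →ₗ[ℝ] V :=
    (LinearMap.toSpanSingleton ℝ V p).comp (EuclideanSpace.proj (𝕜 := ℝ) (0 : Fin 2)).toLinearMap +
    (LinearMap.toSpanSingleton ℝ V q).comp (EuclideanSpace.proj (𝕜 := ℝ) (1 : Fin 2)).toLinearMap
  have hL : ∀ t : ℝ, L !₂[Real.cos t, Real.sin t] = Real.cos t • p + Real.sin t • q := fun t => by
    simp [L]
  have hconc := ((hg.concaveOn hK).smul hc).comp_linearMap L
  let C : ConvexCone ℝ (EuclideanSpace ℝ (Fin 2)) :=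
    { carrier := L ⁻¹' K
      smul_mem' := fun c hc x hx => by
        rw [mem_preimage, map_smul]; exact hK.smul _ hx c hc
      add_mem' := fun x hx y hy => by
        rw [mem_preimage, map_add]; exact hK.add _ hx _ hy }
  refine ⟨C, fun z => c * g (L z), hconc, fun d hd x hx => ?_, fun t ht => ⟨?_, ?_⟩⟩
  · simp only [map_smul]
    rw [hg.smul _ hx d hd]; ring
  · change L _ ∈ K
    rw [hL]; exact hmem t ht
  · simp only [hL]

theorem sinPowConcaveOn (hK : IsCone K) (hg : IsConcaveHomogeneous K g) {p q : V} {c : ℝ}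
    (hc : 0 ≤ c) (m : ℕ) {I : Set ℝ} (hmem : ∀ t ∈ I, Real.cos t • p + Real.sin t • q ∈ K) :
    SinPowConcaveOn m I fun t => c * g (Real.cos t • p + Real.sin t • q) ^ m := by
  refine ⟨fun t ht => mul_nonneg hc (pow_nonneg (hg.nonneg _ (hmem t ht)) m), ?_, fun hm => ?_⟩
  · rintro rfl s _ t _
    simp
  · obtain ⟨C, F, h1, h2, h3⟩ := hg.sinConcaveOn hK (Real.rpow_nonneg hc (m : ℝ)⁻¹) hmem
    refine ⟨C, F, h1, h2, fun t ht => ⟨(h3 t ht).1, ?_⟩⟩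
    have h0 := hg.nonneg _ (hmem t ht)
    rw [(h3 t ht).2]
    beta_reduce
    rw [Real.mul_rpow hc (pow_nonneg h0 m), Real.pow_rpow_inv_natCast h0 hm.ne']

end IsConcaveHomogeneous

/-! ### Upper semicontinuity: measurability and powers -/

theorem UpperSemicontinuousOn.measurable_indicator {X : Type*} [TopologicalSpace X]
    [MeasurableSpace X] [BorelSpace X] {K : Set X} (hK : MeasurableSet K) {g : X → ℝ}
    (hg : UpperSemicontinuousOn g K) (φ : ℝ → ℝ≥0∞) (hφ : Measurable φ) :
    Measurable (K.indicator fun x => φ (g x)) := by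
  refine measurable_of_restrict_of_restrict_compl hK ?_ ?_
  · have h1 : Measurable (K.domRestrict g) :=
      (upperSemicontinuousOn_iff_restrict.2 hg).measurable
    have h2 : K.domRestrict (K.indicator fun x => φ (g x)) = φ ∘ K.domRestrict g := by
      ext x
      exact indicator_of_mem x.2 _
    rw [h2]
    exact hφ.comp h1
  · have : Kᶜ.domRestrict (K.indicator fun x => φ (g x)) = fun _ => 0 := by
      ext x
      exact indicator_of_notMem x.2 _
    rw [this]; exact measurable_const

theorem UpperSemicontinuousOn.const_mul_pow {X Y : Type*} [TopologicalSpace X] [TopologicalSpace Y]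
    {K : Set X} {g : X → ℝ} (hg : UpperSemicontinuousOn g K) (h0 : ∀ x ∈ K, 0 ≤ g x)
    {c : ℝ} (hc : 0 ≤ c) (m : ℕ) {S : Set Y} {i : Y → X} (hi : Continuous i)
    (hS : ∀ y ∈ S, i y ∈ K) : UpperSemicontinuousOn (fun y => c * g (i y) ^ m) S := by
  intro y hy u hu
  have hcont : Continuous fun t : ℝ => c * t ^ m := by fun_prop
  obtain ⟨t, ht, htu⟩ : ∃ t, g (i y) < t ∧ c * t ^ m < u := by
    have h1 : ∀ᶠ t in 𝓝[>] g (i y), c * t ^ m < u :=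
      nhdsWithin_le_nhds ((hcont.tendsto (g (i y))).eventually (gt_mem_nhds hu))
    obtain ⟨t, h2, h3⟩ := (h1.and self_mem_nhdsWithin).exists
    exact ⟨t, h3, h2⟩
  have htend : Tendsto i (𝓝[S] y) (𝓝[K] (i y)) :=
    tendsto_nhdsWithin_iff.2 ⟨hi.continuousAt.tendsto.mono_left nhdsWithin_le_nhds,
      eventually_mem_nhdsWithin.mono fun t ht => hS t ht⟩
  filter_upwards [htend.eventually (hg _ (hS y hy) t ht), self_mem_nhdsWithin] with z hz hzS
  refine lt_of_le_of_lt ?_ htu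
  have := h0 _ (hS z hzS)
  gcongr

/-! ### The great sphere spanned by a convex set -/

section Span

variable {n : ℕ} (V : Submodule ℝ (EuclideanSpace ℝ (Fin (n + 1))))

theorem isometry_greatSphereIncl : Isometry (greatSphereIncl V) := fun _ _ => rfl

theorem isClosedEmbedding_greatSphereIncl : Topology.IsClosedEmbedding (greatSphereIncl V) :=
  (isometry_greatSphereIncl V).isClosedEmbedding

theorem measurableEmbedding_greatSphereIncl : MeasurableEmbedding (greatSphereIncl V) :=
  (isClosedEmbedding_greatSphereIncl V).measurableEmbedding

/-- The trace on `V` of the cone over `S`. -/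
def coneIn (S : Set (Sph n)) : Set V := Subtype.val ⁻¹' coneOver S

variable {V}

theorem mem_coneIn_iff {S : Set (Sph n)} {x : Metric.sphere (0 : V) 1} :
    (x : V) ∈ coneIn V S ↔ greatSphereIncl V x ∈ S := by
  constructor
  · rintro ⟨t, ht, s, hs, h⟩
    have h1 : ‖((x : V) : EuclideanSpace ℝ (Fin (n + 1)))‖ = 1 := norm_eq_of_mem_sphere x
    rw [h, norm_smul, norm_eq_of_mem_sphere, mul_one, Real.norm_of_nonneg ht] at h1
    rw [h1, one_smul] at h
    have : greatSphereIncl V x = s := Subtype.ext h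
    rwa [this]
  · intro h
    exact ⟨1, zero_le_one, _, h, (one_smul _ _).symm⟩

theorem polarMap_mem_coneIn {S : Set (Sph n)} {x : Metric.sphere (0 : V) 1}
    (hx : greatSphereIncl V x ∈ S) (t : Ioi (0 : ℝ)) : polarMap V (x, t) ∈ coneIn V S :=
  ⟨t, le_of_lt t.2.out, _, hx, rfl⟩

theorem SphConvex.isCone_coneIn {S : Set (Sph n)} (hS : SphConvex S) : IsCone (coneIn V S) :=
  ⟨fun x hx y hy => hS.isCone_coneOver.add x hx y hy,
    fun x hx c hc => hS.isCone_coneOver.smul x hx c hc⟩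

theorem IsCone.closure {W : Type*} [NormedAddCommGroup W] [NormedSpace ℝ W] {K : Set W}
    (hK : IsCone K) : IsCone (closure K) :=
  ⟨fun _ hx _ hy => map_mem_closure₂ continuous_add hx hy fun a ha b hb => hK.add a ha b hb,
    fun _ hx c hc => map_mem_closure (continuous_const_smul c) hx fun a ha => hK.smul a ha c hc⟩

/-- A convex set has interior points as soon as its affine span is everything; here the cone
contains 0 and spans `linSpan S`. -/
theorem interior_coneIn_linSpan_nonempty {S : Set (Sph n)} (hS : SphConvex S) (hne : S.Nonempty) :
    (interior (coneIn (linSpan S) S)).Nonempty := by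
  have h0 : (0 : linSpan S) ∈ coneIn (linSpan S) S := by
    obtain ⟨x, hx⟩ := hne
    exact ⟨0, le_rfl, x, hx, (zero_smul _ _).symm⟩
  rw [hS.isCone_coneIn.convex.interior_nonempty_iff_affineSpan_eq_top,
    AffineSubspace.affineSpan_eq_top_iff_vectorSpan_eq_top_of_nonempty ℝ _ _ ⟨0, h0⟩,
    vectorSpan_eq_span_vsub_set_right ℝ h0, eq_top_iff]
  simp only [vsub_eq_sub, sub_zero, image_id']
  have := Submodule.span_span_coe_preimage (R := ℝ)
    (s := (fun x : Sph n => (x : EuclideanSpace ℝ (Fin (n + 1)))) '' S)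
  refine this.symm.le.trans (Submodule.span_mono ?_)
  rintro v ⟨x, hx, hxv⟩
  exact ⟨1, zero_le_one, x, hx, by rw [one_smul]; exact hxv.symm⟩

theorem subset_range_greatSphereIncl (S : Set (Sph n)) :
    S ⊆ range (greatSphereIncl (linSpan S)) := by
  intro x hx
  exact ⟨⟨⟨x, Submodule.subset_span ⟨x, hx, rfl⟩⟩, by simp⟩, rfl⟩

/-- The polar map is open, so a neighbourhood in the great sphere sweeps out a neighbourhood in the
space. -/
theorem mem_interior_coneIn_of_mem_relInterior {S : Set (Sph n)}
    {x : Metric.sphere (0 : linSpan S) 1} (hx : greatSphereIncl (linSpan S) x ∈ relInterior S) :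
    (x : linSpan S) ∈ interior (coneIn (linSpan S) S) := by
  rw [mem_interior_iff_mem_nhds]
  have h1 : ∀ᶠ y in 𝓝 x, greatSphereIncl (linSpan S) y ∈ S := by
    filter_upwards [(isClosedEmbedding_greatSphereIncl (linSpan S)).continuous.continuousAt.eventually
      hx.2] with y hy using hy y.1.2
  have h2 : {y | greatSphereIncl (linSpan S) y ∈ S} ×ˢ univ ∈
      𝓝 (x, (⟨1, mem_Ioi.2 one_pos⟩ : Ioi (0 : ℝ))) := prod_mem_nhds h1 univ_mem
  have h3 := isOpenEmbedding_polarMap.isOpenMap.image_mem_nhds h2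
  have e : polarMap (linSpan S) (x, (⟨1, mem_Ioi.2 one_pos⟩ : Ioi (0 : ℝ))) = x := one_smul _ _
  rw [e] at h3
  refine mem_of_superset h3 ?_
  rintro _ ⟨⟨y, t⟩, ⟨hy, -⟩, rfl⟩
  exact polarMap_mem_coneIn hy t

end Span

/-! ### Descent of the density to the sphere -/

section Density

variable {n : ℕ} {S : Set (Sph n)} {μ : Measure (Sph n)}

/-- The great sphere is closed and contains S, hence contains the support of μ: nothing is lost by
restricting to it. -/
theorem map_comap_greatSphereIncl (hsupp : closure S = μ.support) :
    (μ.comap (greatSphereIncl (linSpan S))).map (greatSphereIncl (linSpan S)) = μ := by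
  rw [(measurableEmbedding_greatSphereIncl _).map_comap]
  refine Measure.restrict_eq_self_of_ae_mem ?_
  have h : closure S ⊆ range (greatSphereIncl (linSpan S)) :=
    (isClosedEmbedding_greatSphereIncl _).isClosed_range.closure_subset_iff.2
      (subset_range_greatSphereIncl S)
  have h1 : ∀ᵐ x ∂μ, x ∈ μ.support := Measure.support_mem_ae
  filter_upwards [h1] with x hx using h (hsupp ▸ hx)

theorem coneMeasure_comap_closedBall [IsFiniteMeasure μ] (hsupp : closure S = μ.support) (p : ℕ)
    (x : linSpan S) (r : ℝ) :
    coneMeasure p (μ.comap (greatSphereIncl (linSpan S))) (Metric.closedBall x r) =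
      coneMeasure p μ (Metric.closedBall (x : EuclideanSpace ℝ (Fin (n + 1))) r) := by
  have hme := measurableEmbedding_greatSphereIncl (linSpan S)
  conv_rhs => rw [← map_comap_greatSphereIncl hsupp,
    coneMeasure_map p _ (linSpan S).subtypeL hme.measurable fun x => rfl,
    Measure.map_apply (linSpan S).subtypeL.continuous.measurable
      Metric.isClosed_closedBall.measurableSet]
  rfl

theorem mem_support_comap (hsupp : closure S = μ.support) {x : Metric.sphere (0 : linSpan S) 1}
    (hx : greatSphereIncl (linSpan S) x ∈ S) :
    x ∈ (μ.comap (greatSphereIncl (linSpan S))).support := by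
  rw [Measure.mem_support_iff_forall]
  intro U hU
  rw [(isClosedEmbedding_greatSphereIncl (linSpan S)).isInducing.nhds_eq_comap] at hU
  obtain ⟨W, hW, hWU⟩ := mem_comap.1 hU
  have hmem : greatSphereIncl (linSpan S) x ∈ μ.support := hsupp ▸ subset_closure hx
  have hpos := (Measure.mem_support_iff_forall _).1 hmem W hW
  rw [← map_comap_greatSphereIncl hsupp,
    (measurableEmbedding_greatSphereIncl _).map_apply] at hpos
  exact hpos.trans_le (measure_mono hWU)

theorem coneMeasure_comap_closedBall_pos [IsFiniteMeasure μ] (hsupp : closure S = μ.support)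
    (p : ℕ) {x : linSpan S} (hx : x ∈ closure (coneIn (linSpan S) S)) {r : ℝ} (hr : 0 < r) :
    0 < coneMeasure p (μ.comap (greatSphereIncl (linSpan S))) (Metric.closedBall x r) := by
  obtain ⟨y, hy, t, ht, s, hs, hys⟩ := mem_closure_iff.1 hx (Metric.ball x r)
    Metric.isOpen_ball (Metric.mem_ball_self hr)
  obtain ⟨s', rfl⟩ := subset_range_greatSphereIncl S hs
  have hy' : y = t • (s' : linSpan S) := Subtype.ext hys
  rw [hy'] at hy
  -- The nearby point of the cone may be the apex, where polar coordinates fail; push it slightly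
  -- outwards.
  obtain ⟨t', ht', hball⟩ : ∃ t' : ℝ, 0 < t' ∧ t' • (s' : linSpan S) ∈ Metric.ball x r := by
    have hc : Continuous fun t : ℝ => t • (s' : linSpan S) := by fun_prop
    have h1 : ∀ᶠ t' in 𝓝[>] t, t' • (s' : linSpan S) ∈ Metric.ball x r :=
      nhdsWithin_le_nhds ((hc.tendsto t).eventually (Metric.isOpen_ball.mem_nhds hy))
    obtain ⟨t', h2, h3⟩ := (h1.and self_mem_nhdsWithin).exists
    exact ⟨t', ht.trans_lt h3, h2⟩
  exact (coneMeasure_pos_of_mem_support p (mem_support_comap hsupp hs) ht' Metric.isOpen_ball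
    hball).trans_le (measure_mono Metric.ball_subset_closedBall)

theorem mem_closure_coneIn {x : Metric.sphere (0 : linSpan S) 1}
    (hx : greatSphereIncl (linSpan S) x ∈ closure S) : (x : linSpan S) ∈ closure (coneIn _ S) := by
  have hx' : x ∈ closure (greatSphereIncl (linSpan S) ⁻¹' S) := by
    rw [(isClosedEmbedding_greatSphereIncl _).isInducing.closure_eq_preimage_closure_image,
      image_preimage_eq_of_subset (subset_range_greatSphereIncl S)]
    exact hx
  exact map_mem_closure continuous_subtype_val hx' fun y hy => mem_coneIn_iff.2 hy

theorem coneMeasure_compl_closure_coneIn [IsFiniteMeasure μ] (hconv : SphConvex S)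
    (hsupp : closure S = μ.support) (p : ℕ) :
    coneMeasure p (μ.comap (greatSphereIncl (linSpan S))) (closure (coneIn (linSpan S) S))ᶜ = 0 := by
  have hme := measurableEmbedding_greatSphereIncl (linSpan S)
  have h0 : (μ.comap (greatSphereIncl (linSpan S))) (greatSphereIncl (linSpan S) ⁻¹' (closure S)ᶜ)
      = 0 := by
    rw [← hme.map_apply, map_comap_greatSphereIncl hsupp, hsupp]
    exact Measure.measure_compl_support
  rw [coneMeasure, measurableEmbedding_polarMap.map_apply]
  refine measure_mono_null (t := (greatSphereIncl (linSpan S) ⁻¹' (closure S)ᶜ) ×ˢ univ) ?_ ?_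
  · rintro ⟨x, t⟩ hxt
    refine ⟨fun hx => hxt ?_, mem_univ _⟩
    exact hconv.isCone_coneIn.closure.smul _ (mem_closure_coneIn hx) t t.2
  · rw [Measure.prod_prod, h0, zero_mul]

/-- The two sets can differ only in the frontier of the cone, which is Lebesgue-null by convexity.
Thus S may replace its closure as the domain of the density. -/
theorem ae_eq_preimage_greatSphereIncl (hconv : SphConvex S) [Nontrivial (linSpan S)]
    (lam : Measure (linSpan S)) [lam.IsAddHaarMeasure] :
    ((↑) ⁻¹' closure (coneIn (linSpan S) S) : Set (Metric.sphere (0 : linSpan S) 1))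
      =ᵐ[lam.toSphere] greatSphereIncl (linSpan S) ⁻¹' S := by
  have hcone := hconv.isCone_coneIn (V := linSpan S)
  have hclosed : MeasurableSet ((↑) ⁻¹' frontier (coneIn (linSpan S) S) :
      Set (Metric.sphere (0 : linSpan S) 1)) :=
    (isClosed_frontier.preimage continuous_subtype_val).measurableSet
  have hnull : lam.toSphere ((↑) ⁻¹' frontier (coneIn (linSpan S) S)) = 0 := by
    rw [Measure.toSphere_apply' _ hclosed]
    -- The measure on the sphere is that of the truncated cone, and the frontier is invariant under
    -- positive dilations.
    refine mul_eq_zero.2 (Or.inr (measure_mono_null ?_ (hcone.convex.addHaar_frontier lam)))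
    rintro _ ⟨t, ht, _, ⟨x, hx, rfl⟩, rfl⟩
    refine ⟨hcone.closure.smul _ hx.1 t ht.1, fun hi => hx.2 ?_⟩
    have := hcone.smul_interior hi (inv_pos.2 ht.1)
    simpa [smul_smul, inv_mul_cancel₀ ht.1.ne'] using this
  filter_upwards [measure_eq_zero_iff_ae_notMem.1 hnull] with x hx
  refine propext ⟨fun hK => ?_, fun hxS => subset_closure (mem_coneIn_iff.2 hxS)⟩
  by_contra hxS
  exact hx ⟨hK, fun hi => hxS (mem_coneIn_iff.1 (interior_subset hi))⟩

theorem map_withDensity_comp {X Y : Type*} [MeasurableSpace X] [MeasurableSpace Y] {i : X → Y}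
    (hi : MeasurableEmbedding i) (σ : Measure X) (ψ : Y → ℝ≥0∞) :
    (σ.withDensity (ψ ∘ i)).map i = (σ.map i).withDensity ψ := by
  ext A hA
  rw [hi.map_apply, withDensity_apply _ (hi.measurable hA), withDensity_apply _ hA,
    hi.restrict_map, hi.lintegral_map]
  rfl

theorem IsConvexelyDerived.exists_density {k : ℕ} (hk : k ≤ n) (hconv : SphConvex S)
    (hdim : SphDim S k) (hμ : IsConvexelyDerived μ) (hsupp : closure S = μ.support) :
    ∃ (c : ℝ) (g : linSpan S → ℝ), 0 ≤ c ∧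
      IsConcaveHomogeneous (closure (coneIn (linSpan S) S)) g ∧
      UpperSemicontinuousOn g (closure (coneIn (linSpan S) S)) ∧
      ContinuousOn g (interior (closure (coneIn (linSpan S) S))) ∧
      μ = ((greatSphereVol (linSpan S)).restrict S).withDensity fun x =>
        ENNReal.ofReal (c * g ((linSpan S).orthogonalProjectionOnto x) ^ (n - k)) := by
  have := hμ.isProbabilityMeasure
  have hdim' : Module.finrank ℝ (linSpan S) = k + 1 := hdim
  have : Nontrivial (linSpan S) := Module.nontrivial_of_finrank_pos (R := ℝ) (by omega)
  have hN : Module.finrank ℝ (linSpan S) + (n - k) = n + 1 := by omega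
  have hne : S.Nonempty := by
    rw [← closure_nonempty_iff, hsupp]
    exact Measure.nonempty_support (IsProbabilityMeasure.ne_zero μ)
  have hme := measurableEmbedding_greatSphereIncl (linSpan S)
  set lam : Measure (linSpan S) := (stdOrthonormalBasis ℝ (linSpan S)).toBasis.addHaar with hlam
  set μ' := μ.comap (greatSphereIncl (linSpan S)) with hμ'
  have : IsFiniteMeasure μ' := ⟨by
    rw [hμ', hme.comap_apply]; exact measure_lt_top _ _⟩
  have := isLocallyFiniteMeasure_coneMeasure n μ'
  have hcone := (hconv.isCone_coneIn (V := linSpan S)).closure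
  obtain ⟨c, g, h1, h2, h3, h4, h5⟩ := exists_density_of_brunn_minkowski (lam := lam)
    (ν := coneMeasure n μ') (K := closure (coneIn (linSpan S) S)) isClosed_closure hcone
    ((interior_coneIn_linSpan_nonempty hconv hne).mono (interior_mono subset_closure))
    (coneMeasure_compl_closure_coneIn hconv hsupp n) (m := n - k) (by omega)
    (fun c hc x r => by rw [hN]; exact coneMeasure_closedBall_smul n μ' hc x r)
    (fun x hx y hy a b R ha hb hR => by
      have pa := coneMeasure_comap_closedBall_pos hsupp n hx ha
      have pb := coneMeasure_comap_closedBall_pos hsupp n hy hb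
      rw [coneMeasure_comap_closedBall hsupp] at pa pb
      rw [hN, hμ', coneMeasure_comap_closedBall hsupp, coneMeasure_comap_closedBall hsupp,
        coneMeasure_comap_closedBall hsupp]
      exact hμ.brunn_minkowski hR pa pb)
  refine ⟨c, g, h1, h2, h3, h4, ?_⟩
  set K := closure (coneIn (linSpan S) S)
  have hmeas : Measurable (K.indicator fun x => ENNReal.ofReal (c * g x ^ (n - k))) :=
    h3.measurable_indicator isClosed_closure.measurableSet
      (fun t => ENNReal.ofReal (c * t ^ (n - k))) (by fun_prop)
  have hlam' : coneMeasure k lam.toSphere = lam := by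
    have := coneMeasure_toSphere lam
    rwa [hdim', Nat.add_sub_cancel] at this
  have hhom : ∀ r : ℝ, 0 < r → ∀ x, (K.indicator fun x => ENNReal.ofReal (c * g x ^ (n - k)))
      (r • x) = ENNReal.ofReal r ^ (n - k) *
        (K.indicator fun x => ENNReal.ofReal (c * g x ^ (n - k))) x := by
    intro r hr x
    by_cases hx : x ∈ K
    · rw [indicator_of_mem hx, indicator_of_mem (hcone.smul x hx r hr), h2.smul x hx r hr,
        ← ENNReal.ofReal_pow hr.le, ← ENNReal.ofReal_mul (by positivity)]
      congr 1; ring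
    · have hx' : r • x ∉ K := fun h => hx (by
        have := hcone.smul _ h r⁻¹ (inv_pos.2 hr)
        rwa [inv_smul_smul₀ hr.ne'] at this)
      rw [indicator_of_notMem hx, indicator_of_notMem hx', mul_zero]
  -- Lebesgue measure on the span has radial part r^k dr; the density of degree n-k raises it to r^n
  -- dr, as in the cone measure of μ.
  have hw := coneMeasure_withDensity k (n - k) lam.toSphere hmeas hhom
  rw [hlam', Nat.add_sub_cancel' hk] at hw
  rw [hw] at h5
  have h6 := coneMeasure_injective n h5
  -- The orthogonal projection serves only to extend g to vectors outside the span; on the great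
  -- sphere it is the identity.
  have h7 : (fun x : Metric.sphere (0 : linSpan S) 1 =>
      (K.indicator fun x => ENNReal.ofReal (c * g x ^ (n - k))) x) =
      ((↑) ⁻¹' K : Set (Metric.sphere (0 : linSpan S) 1)).indicator
      ((fun x : Sph n => ENNReal.ofReal
        (c * g ((linSpan S).orthogonalProjectionOnto x) ^ (n - k))) ∘ greatSphereIncl _) := by
    ext x
    have hp : (linSpan S).orthogonalProjectionOnto (greatSphereIncl (linSpan S) x) = x :=
      Submodule.orthogonalProjectionOnto_mem_subspace_eq_self _
    by_cases hx : (x : linSpan S) ∈ K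
    · rw [indicator_of_mem hx, indicator_of_mem (mem_preimage.2 hx), Function.comp_apply, hp]
    · rw [indicator_of_notMem hx, indicator_of_notMem (fun h => hx (mem_preimage.1 h))]
  rw [h7, withDensity_indicator (isClosed_closure.preimage continuous_subtype_val).measurableSet,
    Measure.restrict_congr_set (ae_eq_preimage_greatSphereIncl hconv lam)] at h6
  rw [← map_comap_greatSphereIncl hsupp, ← hμ', h6, map_withDensity_comp hme, ← hme.restrict_map]
  rfl

end Density

/-! ### The theorem -/

theorem mainTheorem7 (n k : ℕ) (hk : k ≤ n) (S : Set (Sph n)) (hconv : SphConvex S)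
    (hdim : SphDim S k) (μ : Measure (Sph n)) (hμ : IsConvexelyDerived μ)
    (hsupp : closure S = μ.support) :
    IsProbabilityMeasure μ ∧
    ∃ f : Sph n → ℝ,
      (∀ x ∈ S, 0 ≤ f x) ∧
      μ = ((greatSphereVol (linSpan S)).restrict S).withDensity
        (fun x => ENNReal.ofReal (f x)) ∧
      ContinuousOn f (relInterior S) ∧
      UpperSemicontinuousOn f S ∧
      ∀ γ : ℝ → Sph n, IsUnitSpeedGeodesic γ →
        ∀ a b : ℝ, a ≤ b → b - a < 2 * Real.pi → (∀ t ∈ Set.Icc a b, γ t ∈ S) →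
          ContinuousOn (fun t => f (γ t)) (Set.Icc a b) ∧
          SinPowConcaveOn (n - k) (Set.Icc a b) (fun t => f (γ t)) := by
  refine ⟨hμ.isProbabilityMeasure, ?_⟩
  obtain ⟨c, g, hc, hg, husc, hcont, hdens⟩ := hμ.exists_density hk hconv hdim hsupp
  have hcone := (hconv.isCone_coneIn (V := linSpan S)).closure
  set K := closure (coneIn (linSpan S) S) with hK
  have hπ : ∀ x : Metric.sphere (0 : linSpan S) 1,
      (linSpan S).orthogonalProjectionOnto (greatSphereIncl (linSpan S) x) = x :=
    fun x => Submodule.orthogonalProjectionOnto_mem_subspace_eq_self _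
  have hcontπ : Continuous fun x : Sph n => (linSpan S).orthogonalProjectionOnto
      (x : EuclideanSpace ℝ (Fin (n + 1))) := by fun_prop
  have hSK : ∀ x ∈ S, (linSpan S).orthogonalProjectionOnto
      (x : EuclideanSpace ℝ (Fin (n + 1))) ∈ K := by
    intro x hx
    obtain ⟨x, rfl⟩ := subset_range_greatSphereIncl S hx
    rw [hπ]
    exact subset_closure (mem_coneIn_iff.2 hx)
  refine ⟨fun x => c * g ((linSpan S).orthogonalProjectionOnto x) ^ (n - k),
    fun x hx => mul_nonneg hc (pow_nonneg (hg.nonneg _ (hSK x hx)) _), hdens, ?_,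
    husc.const_mul_pow hg.nonneg hc (n - k) hcontπ hSK, ?_⟩
  · refine continuousOn_const.mul (ContinuousOn.pow ?_ _)
    refine hcont.comp hcontπ.continuousOn fun x hx => ?_
    obtain ⟨x, rfl⟩ := subset_range_greatSphereIncl S hx.1
    rw [hπ]
    exact interior_mono subset_closure (mem_interior_coneIn_of_mem_relInterior hx)
  · rintro γ ⟨u, v, -, -, -, hγ⟩ a b - - hmem
    -- Projecting the whole parametrization avoids having to know that u and v lie in the span,
    -- which could fail for an arc reduced to a point.
    have hγ' : ∀ t, (linSpan S).orthogonalProjectionOnto (γ t : EuclideanSpace ℝ (Fin (n + 1))) =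
        Real.cos t • (linSpan S).orthogonalProjectionOnto u +
        Real.sin t • (linSpan S).orthogonalProjectionOnto v := fun t => by
      rw [hγ, map_add, map_smul, map_smul]
    have hmem' : ∀ t ∈ Icc a b, Real.cos t • (linSpan S).orthogonalProjectionOnto u +
        Real.sin t • (linSpan S).orthogonalProjectionOnto v ∈ K := fun t ht =>
      hγ' t ▸ hSK _ (hmem t ht)
    simp only [hγ']
    exact ⟨continuousOn_const.mul ((hg.continuousOn_arc hcone husc hmem').pow _),
      hg.sinPowConcaveOn hcone hc (n - k) hmem'⟩
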